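/- Let $\rho=\frac12+\frac{\sqrt3}{2}i$, and for points $x,y$ of $\mathbb{H}\cup\mathbb{Q}\cup\{\infty\}$ let $H_{x,y}$ be the hyperbolic geodesic arc joining them. An even edge (resp. odd edge) is an image under an element of $\mathrm{PSL}_2(\mathbb{Z})$ of $H_{i,\infty}$ (resp. of $H_{\rho,\infty}$). A special polygon $P$ (with a vertex at $\infty$) is a convex hyperbolic polygon with non-empty interior whose ideal vertices are $\infty$ and rational numbers $x_0<x_1<\dots<x_n$ ($n\ge 0$), together with a side pairing, as follows. Put $x_{-1}=x_{n+1}=\infty$. For each $0\le k\le n+1$ there is $\gamma_k\in \mathrm{PSL}_2(\mathbb{Z})$ with $\gamma_k(0)=x_{k-1}$ and $\gamma_k(\infty)=x_k$, and between $x_{k-1}$ and $x_k$ the polygon carries one of three kinds of pairing. * Even pairing: the boundary of $P$ from $x_{k-1}$ to $x_k$ consists of the two even edges $\gamma_k H_{0,i}$ and $\gamma_k H_{i,\infty}$. These are two sides, and they are paired with each other. * Odd pairing: the boundary of $P$ from $x_{k-1}$ to $x_k$ consists of the two odd edges $\gamma_k H_{0,\rho}$ and $\gamma_k H_{\rho,\infty}$,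 which meet at an interior angle of $2\pi/3$. These are two sides, and they are paired with each other. * Free pairing: the boundary of $P$ from $x_{k-1}$ to $x_k$ is the single side $\gamma_k H_{0,\infty}$. The free sides are partitioned into pairs. The sides are oriented by tracing the boundary of $P$. Let $\Gamma=\Gamma_P\le \mathrm{PSL}_2(\mathbb{Z})$ be the group generated by the side pairing transformations, that is, by the elements of $\mathrm{PSL}_2(\mathbb{Z})$ that map a side to its paired side in an orientation-reversing manner. For $0\le i\le n$ write $x_i=a_i/b_i$ in lowest terms with $b_i>0$, and put $(a_{-1},b_{-1})=(-1,0)$ and $(a_{n+1},b_{n+1})=(1,0)$. Then $a_{i+1}b_i-a_ib_{i+1}=1$ for $-1\le i\le n$. Let $$T=\begin{pmatrix}1&1\\0&1\end{pmatrix},\qquad \varphi_i=\begin{pmatrix}a_i&-a_{i+1}\\ b_i&-b_{i+1}\end{pmatrix}\qquad(-1\le i\le n),$$ so that $\varphi_i\in \mathrm{PSL}_2(\mathbb{Z})$, $\varphi_i^{-1}(x_i)=\infty$ and $\varphi_i^{-1}(x_{i+1})=0$. Indices being cyclic (the vertex preceding $x_{-1}=\infty$ is $x_n$, so for $i=-1$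 read $x_{i-1}$, $a_{i-1}$, $b_{i-1}$ as $x_n$, $a_n$, $b_n$), let $$w_i=\begin{cases}|a_{i-1}b_{i+1}-a_{i+1}b_{i-1}|+1&\text{if the pairing between } x_{i-1}\text{ and }x_i\text{ is odd},\\ |a_{i-1}b_{i+1}-a_{i+1}b_{i-1}|&\text{otherwise.}\end{cases}$$ Then $$\bigcup_{i=-1}^{n}\{\,T^{-j}\varphi_i^{-1} : 0\le j<w_i\,\}$$ is a complete set of representatives of the left cosets $\alpha\Gamma$ of $\Gamma$ in $\mathrm{PSL}_2(\mathbb{Z})$: every left coset contains exactly one element of this set. -/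

import Mathlib

open scoped MatrixGroups OnePoint

noncomputable section

/-- A point of `ℍ ∪ ℚ ∪ {∞}`. -/
inductive ExtPoint where
  | inner (z : UpperHalfPlane)
  | ideal (c : OnePoint ℚ)

/-- The action of `SL(2, ℤ)` by Möbius transformations on `ℚ ∪ {∞}`. -/
def cuspMove (g : SL(2, ℤ)) (c : OnePoint ℚ) : OnePoint ℚ :=
  Matrix.SpecialLinearGroup.mapGL ℚ g • c

/-- The action of `SL(2, ℤ)` by Möbius transformations on `ℍ ∪ ℚ ∪ {∞}`. -/
def ExtPoint.move (g : SL(2, ℤ)) : ExtPoint → ExtPoint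
  | .inner z => .inner (g • z)
  | .ideal c => .ideal (cuspMove g c)

/-- The point `ρ = 1/2 + (√3/2) i`. -/
def rhoPoint : UpperHalfPlane := ⟨⟨1 / 2, Real.sqrt 3 / 2⟩, by positivity⟩

/-- The three kinds of pairing that a pair of consecutive ideal vertices of a special polygon can
carry. -/
inductive PairingKind where
  | even
  | odd
  | free

/-- The sequence `x₋₁ = ∞, x₀, …, xₙ, xₙ₊₁ = ∞`; position `k` holds `xₖ₋₁`. -/
def cuspSeq {n : ℕ} (x : Fin (n + 1) → ℚ) : Fin (n + 3) → OnePoint ℚ :=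
  Fin.cons ∞ (Fin.snoc (α := fun _ => OnePoint ℚ) (fun i => (x i : OnePoint ℚ)) ∞)

/-- Numerators `a₋₁ = -1, a₀, …, aₙ, aₙ₊₁ = 1`; position `k` holds `aₖ₋₁`. -/
def numSeq {n : ℕ} (x : Fin (n + 1) → ℚ) : Fin (n + 3) → ℤ :=
  Fin.cons (-1) (Fin.snoc (α := fun _ => ℤ) (fun i => (x i).num) 1)

/-- Denominators `b₋₁ = 0, b₀, …, bₙ, bₙ₊₁ = 0`; position `k` holds `bₖ₋₁`. -/
def denSeq {n : ℕ} (x : Fin (n + 1) → ℚ) : Fin (n + 3) → ℤ :=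
  Fin.cons 0 (Fin.snoc (α := fun _ => ℤ) (fun i => ((x i).den : ℤ)) 0)

/-- For `γ = 1`, the part of `ℍ` on the left of the boundary piece that runs from `0` to `∞`.
The piece is the imaginary axis (two even edges meeting at `i`) for an even or free pairing, and
`H_{0,ρ} ∪ H_{ρ,∞}` (two odd edges meeting at `ρ`, at an angle of `2π/3` on the left) for an odd
pairing; in the latter case the part on the left is the intersection of the two half-planes that
are bounded by the geodesics through `0, ρ` and `ρ, ∞`. For general `γ` everything is moved
by `γ`. -/
def leftPart (p : PairingKind) (γ : SL(2, ℤ)) : Set UpperHalfPlane :=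
  match p with
  | .odd => {z | (γ⁻¹ • z).re ≤ 1 / 2 ∧ 1 ≤ ‖((γ⁻¹ • z : UpperHalfPlane) : ℂ) - 1‖}
  | _ => {z | (γ⁻¹ • z).re ≤ 0}

/-- A special polygon with an ideal vertex at `∞`: a convex hyperbolic polygon bounded by even
and odd edges, with its side pairing. Its ideal vertices are `∞` and rational numbers
`x₀ < ⋯ < xₙ`. Consecutive ideal vertices `xₖ₋₁, xₖ` (`k = 0, …, n + 1`,
with `x₋₁ = xₙ₊₁ = ∞`) are joined by
* the image under `frame k` of the imaginary axis, made of the even edges `(frame k) H_{0,i}` and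
  `(frame k) H_{i,∞}`, for an even or free pairing;
* the images under `frame k` of `H_{0,ρ}` and `H_{ρ,∞}`, which are odd edges, for an odd pairing.
Here `frame k` is the element of `PSL(2, ℤ)` (given through a matrix) that takes `0` to `xₖ₋₁`
and `∞` to `xₖ`. The boundary is run through with the polygon on its left. -/
structure SpecialPolygon where
  n : ℕ
  x : Fin (n + 1) → ℚ
  strictMono_x : StrictMono x
  kind : Fin (n + 2) → PairingKind
  frame : Fin (n + 2) → SL(2, ℤ)
  frame_zero : ∀ k, cuspMove (frame k) ((0 : ℚ) : OnePoint ℚ) = cuspSeq x k.castSucc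
  frame_infty : ∀ k, cuspMove (frame k) ∞ = cuspSeq x k.succ
  /-- The region `⋂ k, leftPart (kind k) (frame k)` is a genuine polygon, not just an arc. -/
  interior_nonempty : (interior (⋂ k, leftPart (kind k) (frame k))).Nonempty
  /-- The partition of the free sides into sets of two. -/
  partner : Fin (n + 2) → Fin (n + 2)
  partner_partner : ∀ k, partner (partner k) = k
  partner_eq_self_iff : ∀ k, partner k = k ↔ kind k ≠ .free

/-- An oriented hyperbolic arc, given by its initial and its terminal point (which determine it).
An element of `SL(2, ℤ)` takes an arc to the arc between the images of the end points. -/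
structure OrientedArc where
  source : ExtPoint
  target : ExtPoint

/-- `γ` maps the arc `s` onto the arc `t` and reverses the orientation. -/
def MapsReversing (γ : SL(2, ℤ)) (s t : OrientedArc) : Prop :=
  s.source.move γ = t.target ∧ s.target.move γ = t.source

lemma cuspMove_infty (g : SL(2, ℤ)) :
    cuspMove g ∞ = if g 1 0 = 0 then ∞ else (((g 0 0 : ℚ) / (g 1 0 : ℚ) : ℚ) : OnePoint ℚ) := by
  simp [cuspMove, OnePoint.smul_infty_eq_ite]
lemma cuspMove_zero (g : SL(2, ℤ)) :
    cuspMove g ((0 : ℚ) : OnePoint ℚ) =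
      if g 1 1 = 0 then ∞ else (((g 0 1 : ℚ) / (g 1 1 : ℚ) : ℚ) : OnePoint ℚ) := by
  simp [cuspMove, OnePoint.smul_some_eq_ite]

lemma exists_sign {p q : ℤ} (h : IsCoprime p q) (hq : q ≠ 0) :
    ∃ e : ℤ, e * e = 1 ∧ ((p : ℚ) / q).num = e * p ∧ ((((p : ℚ) / q).den : ℕ) : ℤ) = e * q := by
  rcases lt_or_gt_of_ne hq with hq | hq
  · refine ⟨-1, by norm_num, ?_, ?_⟩
    · have := Rat.num_div_eq_of_coprime (a := -p) (b := -q) (by omega)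
        (by simpa [Int.gcd, Nat.Coprime] using Int.isCoprime_iff_gcd_eq_one.1 h)
      simpa using this
    · have := Rat.den_div_eq_of_coprime (a := -p) (b := -q) (by omega)
        (by simpa [Int.gcd, Nat.Coprime] using Int.isCoprime_iff_gcd_eq_one.1 h)
      simpa using this
  · refine ⟨1, by norm_num, ?_, ?_⟩
    · have := Rat.num_div_eq_of_coprime (a := p) (b := q) hq
        (by simpa [Int.gcd, Nat.Coprime] using Int.isCoprime_iff_gcd_eq_one.1 h)
      simpa using this
    · have := Rat.den_div_eq_of_coprime (a := p) (b := q) hq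
        (by simpa [Int.gcd, Nat.Coprime] using Int.isCoprime_iff_gcd_eq_one.1 h)
      simpa using this


/-- Consecutive ideal vertices in lowest terms satisfy `aₖ bₖ₋₁ - aₖ₋₁ bₖ = 1`. -/
lemma farey_relation {n : ℕ} {x : Fin (n + 1) → ℚ} (hx : StrictMono x) (k : Fin (n + 2))
    (g : SL(2, ℤ)) (h0 : cuspMove g ((0 : ℚ) : OnePoint ℚ) = cuspSeq x k.castSucc)
    (h1 : cuspMove g ∞ = cuspSeq x k.succ) :
    numSeq x k.succ * denSeq x k.castSucc - numSeq x k.castSucc * denSeq x k.succ = 1 := by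
  have hdet : g 0 0 * g 1 1 - g 0 1 * g 1 0 = 1 := by
    have := g.det_coe
    rwa [Matrix.det_fin_two] at this
  have c1 : IsCoprime (g 0 0) (g 1 0) := ⟨g 1 1, - g 0 1, by linarith⟩
  have c0 : IsCoprime (g 0 1) (g 1 1) := ⟨- g 1 0, g 0 0, by linarith⟩
  have s0 : (cuspSeq x k.castSucc = ∞ ∧ numSeq x k.castSucc = -1 ∧ denSeq x k.castSucc = 0 ∧ k = 0) ∨
      ∃ i : Fin (n + 1), k = i.succ ∧ cuspSeq x k.castSucc = (x i : OnePoint ℚ) ∧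
        numSeq x k.castSucc = (x i).num ∧ denSeq x k.castSucc = ((x i).den : ℤ) := by
    refine Fin.cases (Or.inl ?_) (fun i => Or.inr ⟨i, rfl, ?_⟩) k
    · simp [cuspSeq, numSeq, denSeq]
    · rw [← Fin.succ_castSucc]
      simp [cuspSeq, numSeq, denSeq]
  have s1 : (cuspSeq x k.succ = ∞ ∧ numSeq x k.succ = 1 ∧ denSeq x k.succ = 0 ∧ k = Fin.last _) ∨
      ∃ i : Fin (n + 1), k = i.castSucc ∧ cuspSeq x k.succ = (x i : OnePoint ℚ) ∧
        numSeq x k.succ = (x i).num ∧ denSeq x k.succ = ((x i).den : ℤ) := by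
    refine Fin.lastCases (Or.inl ?_) (fun i => Or.inr ⟨i, rfl, ?_⟩) k
    · simp [cuspSeq, numSeq, denSeq]
    · simp [cuspSeq, numSeq, denSeq]
  rw [cuspMove_zero] at h0
  rw [cuspMove_infty] at h1
  rcases s0 with ⟨e0, a0, b0, k0⟩ | ⟨i, k0, e0, a0, b0⟩ <;>
    rcases s1 with ⟨e1, a1, b1, k1⟩ | ⟨j, k1, e1, a1, b1⟩ <;>
    rw [e0] at h0 <;> rw [e1] at h1 <;> rw [a0, b0, a1, b1]
  · exfalso; rw [k0] at k1; simp [Fin.ext_iff] at k1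
  · have d0 : g 1 1 = 0 := by by_contra h; simp [h] at h0
    rw [d0] at hdet
    have d1 : g 1 0 ≠ 0 := by rintro h; simp [h] at hdet
    rw [if_neg d1, OnePoint.coe_eq_coe] at h1
    obtain ⟨e, he, hn, hd⟩ := exists_sign c1 d1
    rw [h1] at hn hd
    have hu : g 1 0 = 1 ∨ g 1 0 = -1 := Int.isUnit_iff.1 (IsUnit.of_mul_eq_one (- g 0 1) (by linarith))
    have he' : e = 1 ∨ e = -1 := Int.isUnit_iff.1 (IsUnit.of_mul_eq_one e he)
    have := (x j).den_pos
    rcases hu with h | h <;> rcases he' with h' | h' <;> rw [h, h'] at hd <;> omega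
  · have d0 : g 1 0 = 0 := by by_contra h; simp [h] at h1
    rw [d0] at hdet
    have d1 : g 1 1 ≠ 0 := by rintro h; simp [h] at hdet
    rw [if_neg d1, OnePoint.coe_eq_coe] at h0
    obtain ⟨e, he, hn, hd⟩ := exists_sign c0 d1
    rw [h0] at hn hd
    have hu : g 1 1 = 1 ∨ g 1 1 = -1 := Int.isUnit_iff.1 (IsUnit.of_mul_eq_one (g 0 0) (by linarith))
    have he' : e = 1 ∨ e = -1 := Int.isUnit_iff.1 (IsUnit.of_mul_eq_one e he)
    have := (x i).den_pos
    rcases hu with h | h <;> rcases he' with h' | h' <;> rw [h, h'] at hd <;> omega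
  · have d0 : g 1 1 ≠ 0 := by rintro h; simp [h] at h0
    have d1 : g 1 0 ≠ 0 := by rintro h; simp [h] at h1
    rw [if_neg d0, OnePoint.coe_eq_coe] at h0
    rw [if_neg d1, OnePoint.coe_eq_coe] at h1
    obtain ⟨e, he, hn, hd⟩ := exists_sign c0 d0
    obtain ⟨f, hf, hn', hd'⟩ := exists_sign c1 d1
    rw [h0] at hn hd
    rw [h1] at hn' hd'
    have hij : x i < x j := by
      apply hx
      rw [k0] at k1
      have := congrArg Fin.val k1
      simp at this
      exact Fin.lt_def.2 (by omega)
    rw [Rat.lt_iff] at hij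
    rw [hn, hd, hn', hd'] at hij ⊢
    have he' : e = 1 ∨ e = -1 := Int.isUnit_iff.1 (IsUnit.of_mul_eq_one e he)
    have hf' : f = 1 ∨ f = -1 := Int.isUnit_iff.1 (IsUnit.of_mul_eq_one f hf)
    rcases he' with h | h <;> rcases hf' with h' | h' <;> rw [h, h'] at hij ⊢ <;> linarith

namespace SpecialPolygon

variable (P : SpecialPolygon)

/-- The special polygon as a subset of `ℍ`. -/
def region : Set UpperHalfPlane := ⋂ k, leftPart (P.kind k) (P.frame k)

/-- The ideal vertex `xₖ₋₁`, where the `k`-th boundary piece starts. -/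
def initialCusp (k : Fin (P.n + 2)) : ExtPoint := .ideal (cuspSeq P.x k.castSucc)

/-- The ideal vertex `xₖ`, where the `k`-th boundary piece ends. -/
def terminalCusp (k : Fin (P.n + 2)) : ExtPoint := .ideal (cuspSeq P.x k.succ)

/-- The common end point in `ℍ` of the two even edges that form the `k`-th boundary piece. -/
def evenPoint (k : Fin (P.n + 2)) : ExtPoint := .inner (P.frame k • UpperHalfPlane.I)

/-- The common end point in `ℍ` of the two odd edges that form the `k`-th boundary piece. -/
def oddPoint (k : Fin (P.n + 2)) : ExtPoint := .inner (P.frame k • rhoPoint)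

/-- The side pairing. Sides carry the orientation of the boundary of the polygon. -/
inductive SidePairing : OrientedArc → OrientedArc → Prop
  | even (k : Fin (P.n + 2)) (h : P.kind k = .even) :
      SidePairing ⟨P.initialCusp k, P.evenPoint k⟩ ⟨P.evenPoint k, P.terminalCusp k⟩
  | odd (k : Fin (P.n + 2)) (h : P.kind k = .odd) :
      SidePairing ⟨P.initialCusp k, P.oddPoint k⟩ ⟨P.oddPoint k, P.terminalCusp k⟩
  | free (k : Fin (P.n + 2)) (h : P.kind k = .free) :
      SidePairing ⟨P.initialCusp k, P.terminalCusp k⟩ ⟨P.initialCusp (P.partner k), P.terminalCusp (P.partner k)⟩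

/-- The group `Γ_P` generated by the side pairing transformations. -/
def group : Subgroup PSL(2, ℤ) :=
  Subgroup.closure {α | ∃ (γ : SL(2, ℤ)) (s t : OrientedArc),
    P.SidePairing s t ∧ MapsReversing γ s t ∧ α = QuotientGroup.mk γ}

/-- The numerator `aₖ₋₁` of the ideal vertex `xₖ₋₁`. -/
def a (k : Fin (P.n + 3)) : ℤ := numSeq P.x k

/-- The denominator `bₖ₋₁` of the ideal vertex `xₖ₋₁`. -/
def b (k : Fin (P.n + 3)) : ℤ := denSeq P.x k

/-- For `k = i + 1`, the matrix of determinant `1` with columns `(aᵢ, bᵢ)`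
and `-(aᵢ₊₁, bᵢ₊₁)`. It takes `∞` to `xᵢ` and `0` to `xᵢ₊₁`. -/
def phi (k : Fin (P.n + 2)) : SL(2, ℤ) :=
  ⟨!![P.a k.castSucc, -P.a k.succ; P.b k.castSucc, -P.b k.succ], by
    have h := farey_relation P.strictMono_x k (P.frame k) (P.frame_zero k) (P.frame_infty k)
    rw [Matrix.det_fin_two_of]
    simp only [a, b]
    linarith⟩

/-- For `k = i + 1`, the number `|aᵢ₋₁ bᵢ₊₁ - aᵢ₊₁ bᵢ₋₁|`, plus `1` if the pairing
between `xᵢ₋₁` and `xᵢ` is odd. Indices are cyclic: the vertex before `x₋₁ = ∞` is `xₙ`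
(`k - 1` is taken in `Fin (n + 2)`, so it is `n + 1` for `k = 0`). -/
def width (k : Fin (P.n + 2)) : ℕ :=
  (P.a (k - 1).castSucc * P.b k.succ - P.a k.succ * P.b (k - 1).castSucc).natAbs +
    match P.kind (k - 1) with
    | .odd => 1
    | _ => 0

end SpecialPolygon

end

/-!
The right action of `PSL(2, ℤ)` on itself carries the combinatorics of the Farey tessellation: an
element `g` stands for the third of the Farey triangle `g (0, 1, ∞)` that lies along the edge
`g (0, ∞)`, the half-turn `S` about `i` crosses this edge, and the rotation `U` of order three about
`ρ` turns to the next third of the same triangle. The special polygon `P` consists of such thirds,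
its tiles. Modify `S` on the tiles by continuing at the partner when the crossed side belongs to
`P`, and `U` by fixing every tile that is a single third beyond an odd side, as such a third is
glued to itself. These permutations have orders dividing two and three, so they define a right
action of `PSL(2, ℤ) = ℤ/2 * ℤ/3` on the set of tiles. The orbit map of one tile is then a map from
`PSL(2, ℤ)` onto the tiles that fixes every tile, and it is invariant under `Γ` on the left because
it is so under each side pairing. Conversely `p S` and `p U` agree up to `Γ` with what replaces
them, so the map only moves points within their `Γ`-orbits; hence each coset `Γ g` contains exactly
one tile, and inversion gives left cosets.

The tiles at the vertex `xᵢ` are the `φᵢ Tʲ` with `0 ≤ j < wᵢ`: since no Farey edge crosses the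
sides of the ideal polygon spanned by the cusps of `P`, `|aᵢ₋₁ bᵢ₊₁ - aᵢ₊₁ bᵢ₋₁|` of its Farey
triangles meet at `xᵢ`, and an odd side adds the third of a triangle beyond it.
-/

section PingPong

open scoped Pointwise

/-- The homomorphism from the cyclic group of order `n` that sends the standard generator to an
element `x` with `x ^ n = 1`. -/
def zmodPowersHom {G : Type*} [Group G] {n : ℕ} (x : G) (hx : x ^ n = 1) :
    Multiplicative (ZMod n) →* G :=
  AddMonoidHom.toMultiplicativeLeft
    (ZMod.lift n ⟨zmultiplesHom (Additive G) (Additive.ofMul x), by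
      simpa using congrArg Additive.ofMul hx⟩)

lemma zmodPowersHom_ofAdd_intCast {G : Type*} [Group G] {n : ℕ} (x : G) (hx : x ^ n = 1) (k : ℤ) :
    zmodPowersHom x hx (Multiplicative.ofAdd (k : ZMod n)) = x ^ k := by
  simp [zmodPowersHom]

lemma zmodPowersHom_generator {G : Type*} [Group G] {n : ℕ} (x : G) (hx : x ^ n = 1) :
    zmodPowersHom x hx (Multiplicative.ofAdd 1) = x := by
  simpa using zmodPowersHom_ofAdd_intCast x hx 1

lemma zmodPowersHom_apply {G : Type*} [Group G] {n : ℕ} [NeZero n] (x : G) (hx : x ^ n = 1)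
    (c : Multiplicative (ZMod n)) : zmodPowersHom x hx c = x ^ c.toAdd.val := by
  rw [← zpow_natCast, ← zmodPowersHom_ofAdd_intCast x hx, Int.cast_natCast, ZMod.natCast_zmod_val,
    ofAdd_toAdd]

variable {ι G α : Type*} [Nontrivial ι] [Group G] [MulAction G α] {g : ι → G} {n : ι → ℕ}
  [∀ i, NeZero (n i)]

lemma coprodI_lift_zmodPowersHom_injective (hg : ∀ i, g i ^ n i = 1) (hn : ∃ i, 3 ≤ n i)
    (X : ι → Set α) (hX : ∀ i, (X i).Nonempty) (hdisj : Pairwise (Function.onFun Disjoint X))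
    (hpp : ∀ i j, i ≠ j → ∀ k, 0 < k → k < n i → g i ^ k • X j ⊆ X i) :
    Function.Injective (Monoid.CoprodI.lift fun i => zmodPowersHom (g i) (hg i)) := by
  refine Monoid.CoprodI.lift_injective_of_ping_pong _ (Or.inr ?_) X hX hdisj ?_
  · obtain ⟨i, hi⟩ := hn
    refine ⟨i, ?_⟩
    rw [← Cardinal.mk_congr Multiplicative.ofAdd, Cardinal.mk_fintype, ZMod.card]
    exact_mod_cast hi
  · intro i j hij c hc
    rw [zmodPowersHom_apply]
    refine hpp i j hij _ (Nat.pos_of_ne_zero fun h => hc ?_) (ZMod.val_lt _)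
    exact Multiplicative.toAdd.injective ((ZMod.val_eq_zero _).1 h)

theorem exists_monoidHom_of_ping_pong (hg : ∀ i, g i ^ n i = 1)
    (hgen : Subgroup.closure (Set.range g) = ⊤) (hn : ∃ i, 3 ≤ n i)
    (X : ι → Set α) (hX : ∀ i, (X i).Nonempty) (hdisj : Pairwise (Function.onFun Disjoint X))
    (hpp : ∀ i j, i ≠ j → ∀ k, 0 < k → k < n i → g i ^ k • X j ⊆ X i)
    {K : Type*} [Group K] (y : ι → K) (hy : ∀ i, y i ^ n i = 1) :
    ∃ ψ : G →* K, ∀ i, ψ (g i) = y i := by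
  let F := Monoid.CoprodI.lift fun i => zmodPowersHom (g i) (hg i)
  let gen (i : ι) : Monoid.CoprodI fun i => Multiplicative (ZMod (n i)) :=
    .of (i := i) (Multiplicative.ofAdd 1)
  have F_gen (i : ι) : F (gen i) = g i := by
    rw [Monoid.CoprodI.lift_of, zmodPowersHom_generator]
  have F_injective : Function.Injective F :=
    coprodI_lift_zmodPowersHom_injective hg hn X hX hdisj hpp
  have F_surjective : Function.Surjective F := by
    rw [← MonoidHom.range_eq_top, eq_top_iff, ← hgen, Subgroup.closure_le]
    rintro _ ⟨i, rfl⟩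
    exact ⟨_, F_gen i⟩
  let e := MulEquiv.ofBijective F ⟨F_injective, F_surjective⟩
  refine ⟨(Monoid.CoprodI.lift fun i => zmodPowersHom (y i) (hy i)).comp e.symm.toMonoidHom,
    fun i => ?_⟩
  have e_symm_gen : e.symm.toMonoidHom (g i) = gen i :=
    e.symm_apply_eq.2 (F_gen i).symm
  rw [MonoidHom.comp_apply, e_symm_gen, Monoid.CoprodI.lift_of, zmodPowersHom_generator]

end PingPong

noncomputable section ModularGroup

open ModularGroup
open scoped UpperHalfPlane Pointwise

lemma psl_mk_eq_mk_iff {R : Type*} [CommRing R] [IsDomain R] (g h : SL(2, R)) :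
    (QuotientGroup.mk g : PSL(2, R)) = QuotientGroup.mk h ↔ g = h ∨ g = -h := by
  rw [eq_comm, QuotientGroup.eq, Matrix.SpecialLinearGroup.mem_center_iff, Fintype.card_fin]
  constructor
  · rintro ⟨r, hr, hrgh⟩
    rw [sq, mul_self_eq_one_iff] at hr
    have inv_mul_eq : h⁻¹ * g = 1 ∨ h⁻¹ * g = -1 := hr.imp
      (fun hr => Subtype.ext <| by rw [← hrgh, hr, map_one]; rfl)
      (fun hr => Subtype.ext <| by rw [← hrgh, hr, map_neg, map_one]; rfl)
    simpa only [inv_mul_eq_iff_eq_mul, mul_one, mul_neg_one] using inv_mul_eq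
  · rintro (rfl | rfl)
    · exact ⟨1, by simp, by simp⟩
    · exact ⟨-1, by simp, by rw [map_neg, map_one]; simp⟩

lemma psl_mk_neg {R : Type*} [CommRing R] [IsDomain R] (g : SL(2, R)) :
    (QuotientGroup.mk (-g) : PSL(2, R)) = QuotientGroup.mk g :=
  (psl_mk_eq_mk_iff _ _).2 (Or.inr rfl)

lemma re_S_smul (z : ℍ) : (S • z).re = -z.re / Complex.normSq z := by
  rw [UpperHalfPlane.modular_S_smul, UpperHalfPlane.mk_re, Complex.inv_re]
  simp

lemma re_S_smul_neg_iff {z : ℍ} : (S • z).re < 0 ↔ 0 < z.re := by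
  rw [re_S_smul, neg_div, neg_lt_zero, div_pos_iff_of_pos_right (UpperHalfPlane.normSq_pos z)]

lemma re_S_smul_pos_iff {z : ℍ} : 0 < (S • z).re ↔ z.re < 0 := by
  rw [re_S_smul, div_pos_iff_of_pos_right (UpperHalfPlane.normSq_pos z), neg_pos]

lemma re_TS_smul_pos {z : ℍ} (hz : z.re < 0) : 0 < ((T * S) • z).re := by
  rw [mul_smul, re_T_smul]
  linarith [re_S_smul_pos_iff.2 hz]

lemma TS_mul_TS : T * S * (T * S) = S * T⁻¹ := by decide

lemma re_TS_mul_TS_smul_pos {z : ℍ} (hz : z.re < 0) : 0 < ((T * S * (T * S)) • z).re := by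
  rw [TS_mul_TS, mul_smul, re_S_smul_pos_iff, re_T_inv_smul]
  linarith

/-- The element `z ↦ -1 / z` of order two in `PSL(2, ℤ)`: the half-turn about `i`. -/
def pslS : PSL(2, ℤ) := QuotientGroup.mk S

/-- The element `z ↦ 1 - 1 / z` of order three in `PSL(2, ℤ)`: the rotation about
`1 / 2 + (√3 / 2) i` that takes `0` to `∞`. -/
def pslU : PSL(2, ℤ) := QuotientGroup.mk (T * S)

lemma mk_T_eq : (QuotientGroup.mk T : PSL(2, ℤ)) = pslU * pslS := by
  rw [pslU, pslS, ← QuotientGroup.mk_mul, show T * S * S = -T by decide, psl_mk_neg]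

lemma pslS_sq : pslS ^ 2 = 1 := by
  rw [pslS, ← QuotientGroup.mk_pow, show S ^ 2 = -1 by decide, psl_mk_neg, QuotientGroup.mk_one]

lemma pslU_pow_three : pslU ^ 3 = 1 := by
  rw [pslU, ← QuotientGroup.mk_pow, show (T * S) ^ 3 = -1 by decide, psl_mk_neg,
    QuotientGroup.mk_one]

lemma pslS_mul_self : pslS * pslS = 1 := by rw [← sq, pslS_sq]

lemma closure_pslS_pslU : Subgroup.closure {pslS, pslU} = ⊤ := by
  have pslS_mem : pslS ∈ Subgroup.closure {pslS, pslU} := Subgroup.subset_closure (by simp)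
  have pslU_mem : pslU ∈ Subgroup.closure {pslS, pslU} := Subgroup.subset_closure (by simp)
  rw [eq_top_iff,
    ← Subgroup.map_top_of_surjective _ (QuotientGroup.mk'_surjective (Subgroup.center SL(2, ℤ))),
    ← SpecialLinearGroup.SL2Z_generators, MonoidHom.map_closure, Set.image_pair,
    Subgroup.closure_le, Set.pair_subset_iff]
  refine ⟨pslS_mem, ?_⟩
  rw [QuotientGroup.mk'_apply, mk_T_eq]
  exact mul_mem pslU_mem pslS_mem

/-- `PSL(2, ℤ)` acts on the upper half-plane, as `-1` acts trivially. -/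
instance : MulAction PSL(2, ℤ) ℍ :=
  .compHom ℍ <| QuotientGroup.lift _ (MulAction.toPermHom SL(2, ℤ) ℍ) fun g hg => by
    have mk_eq_one : (QuotientGroup.mk g : PSL(2, ℤ)) = QuotientGroup.mk 1 := by
      rwa [eq_comm, QuotientGroup.eq, inv_one, one_mul]
    ext1 z
    obtain rfl | rfl := (psl_mk_eq_mk_iff _ _).1 mk_eq_one
    · simp
    · exact (SL_neg_smul 1 z).trans (one_smul _ z)

lemma pslS_smul_subset : pslS • {z : ℍ | 0 < z.re} ⊆ {z | z.re < 0} :=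
  Set.smul_set_subset_iff.2 fun _ => re_S_smul_neg_iff.2

lemma pslU_smul_subset : pslU • {z : ℍ | z.re < 0} ⊆ {z | 0 < z.re} :=
  Set.smul_set_subset_iff.2 fun _ => re_TS_smul_pos

lemma pslU_sq_smul_subset : pslU ^ 2 • {z : ℍ | z.re < 0} ⊆ {z | 0 < z.re} := by
  rw [sq, pslU, ← QuotientGroup.mk_mul]
  exact Set.smul_set_subset_iff.2 fun _ => re_TS_mul_TS_smul_pos

theorem exists_psl_hom {K : Type*} [Group K] {x y : K} (hx : x ^ 2 = 1) (hy : y ^ 3 = 1) :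
    ∃ ψ : PSL(2, ℤ) →* K, ψ pslS = x ∧ ψ pslU = y := by
  have : ∀ i, NeZero (![2, 3] i) := Fin.forall_fin_two.2 ⟨⟨two_ne_zero⟩, ⟨three_ne_zero⟩⟩
  refine (exists_monoidHom_of_ping_pong (α := ℍ) (g := ![pslS, pslU]) (n := ![2, 3])
    (Fin.forall_fin_two.2 ⟨pslS_sq, pslU_pow_three⟩)
    (by rw [Matrix.range_cons_cons_empty, closure_pslS_pslU]) ⟨1, le_rfl⟩
    ![{z | z.re < 0}, {z | 0 < z.re}]
    (Fin.forall_fin_two.2 ⟨⟨⟨⟨-1, 1⟩, one_pos⟩, by simp⟩, ⟨⟨⟨1, 1⟩, one_pos⟩, by simp⟩⟩)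
    (fun i j hij => ?_) (fun i j hij k hk_pos hk => ?_)
    ![x, y] (Fin.forall_fin_two.2 ⟨hx, hy⟩)).imp fun ψ hψ => ⟨hψ 0, hψ 1⟩
  · have half_planes_disjoint : Disjoint {z : ℍ | z.re < 0} {z | 0 < z.re} :=
      Set.disjoint_left.2 fun _ (h : _ < (0 : ℝ)) => h.not_gt
    fin_cases i <;> fin_cases j
    exacts [absurd rfl hij, half_planes_disjoint, half_planes_disjoint.symm, absurd rfl hij]
  · fin_cases i <;> fin_cases j
    · exact absurd rfl hij
    · obtain rfl : k = 1 := by change k < 2 at hk; lia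
      simpa using pslS_smul_subset
    · obtain rfl | rfl : k = 1 ∨ k = 2 := by change k < 3 at hk; lia
      · simpa using pslU_smul_subset
      · exact pslU_sq_smul_subset
    · exact absurd rfl hij

open scoped RightActions

theorem exists_psl_rightAction {X : Type*} {σ τ : Equiv.Perm X} (hσ : σ ^ 2 = 1) (hτ : τ ^ 3 = 1) :
    ∃ _ : MulAction PSL(2, ℤ)ᵐᵒᵖ X, ∀ x : X, x <• pslS = σ x ∧ x <• pslU = τ x := by
  obtain ⟨ψ, ψ_pslS, ψ_pslU⟩ := exists_psl_hom (x := σ⁻¹) (y := τ⁻¹)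
    (by rw [inv_pow, hσ, inv_one]) (by rw [inv_pow, hτ, inv_one])
  refine ⟨.compHom X ((MulEquiv.inv' (Equiv.Perm X)).symm.toMonoidHom.comp ψ.op), fun x => ⟨?_, ?_⟩⟩
  · change (ψ pslS)⁻¹ x = σ x
    rw [ψ_pslS, inv_inv]
  · change (ψ pslU)⁻¹ x = τ x
    rw [ψ_pslU, inv_inv]

end ModularGroup

section Fold

open scoped RightActions Pointwise

variable {G : Type*} [Group G] {J : Set G} [MulAction Gᵐᵒᵖ J]

/-- The folding map of `G` onto a subset `J` on which `G` acts from the right: the right-equivariant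
map `G → J` that fixes the base point `p₀`. -/
def foldOnto (p₀ : J) (g : G) : J := p₀ <• ((p₀ : G)⁻¹ * g)

variable (p₀ : J)

lemma foldOnto_mul (g h : G) : foldOnto p₀ (g * h) = foldOnto p₀ g <• h := by
  rw [foldOnto, ← mul_assoc, MulOpposite.op_mul, mul_smul, foldOnto]

lemma mul_inv_smul_mem {S : Set G} (hS : Subgroup.closure S = ⊤) {Γ : Subgroup G}
    (hΓ : ∀ s ∈ S, ∀ p : J, (p : G) * s * ((p <• s : J) : G)⁻¹ ∈ Γ) (g : G) (p : J) :
    (p : G) * g * ((p <• g : J) : G)⁻¹ ∈ Γ := by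
  have hg : g ∈ Subgroup.closure S := hS ▸ Subgroup.mem_top g
  induction hg using Subgroup.closure_induction generalizing p with
  | mem s hs => exact hΓ s hs p
  | one => simp
  | mul g h _ _ hg hh =>
    have := mul_mem (hg p) (hh (p <• g))
    simpa [mul_assoc, mul_smul] using this
  | inv g _ hg =>
    have := inv_mem (hg (p <• g⁻¹))
    simpa [mul_assoc] using this

lemma mul_inv_foldOnto_mem {S : Set G} (hS : Subgroup.closure S = ⊤) {Γ : Subgroup G}
    (hΓ : ∀ s ∈ S, ∀ p : J, (p : G) * s * ((p <• s : J) : G)⁻¹ ∈ Γ) (g : G) :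
    g * (foldOnto p₀ g : G)⁻¹ ∈ Γ := by
  simpa [foldOnto] using mul_inv_smul_mem hS hΓ ((p₀ : G)⁻¹ * g) p₀

lemma foldOnto_mul_left {R : Set G} (hR : ∀ γ ∈ R, ∃ g, foldOnto p₀ (γ * g) = foldOnto p₀ g)
    {γ : G} (hγ : γ ∈ Subgroup.closure R) (g : G) : foldOnto p₀ (γ * g) = foldOnto p₀ g := by
  induction hγ using Subgroup.closure_induction generalizing g with
  | mem γ hγ =>
    obtain ⟨h, hh⟩ := hR γ hγ
    rw [← mul_inv_cancel_left h g, ← mul_assoc, foldOnto_mul, hh, ← foldOnto_mul]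
  | one => rw [one_mul]
  | mul γ δ _ _ hγ hδ => rw [mul_assoc, hγ, hδ]
  | inv γ _ hγ => rw [← hγ, mul_inv_cancel_left]

theorem isComplement_inv_closure_of_foldOnto {S R : Set G} (hS : Subgroup.closure S = ⊤)
    (hJ : ∀ p : J, foldOnto p₀ p = p)
    (hSR : ∀ s ∈ S, ∀ p : J, (p : G) * s * ((p <• s : J) : G)⁻¹ ∈ Subgroup.closure R)
    (hR : ∀ γ ∈ R, ∃ g, foldOnto p₀ (γ * g) = foldOnto p₀ g) :
    Subgroup.IsComplement J⁻¹ (Subgroup.closure R : Set G) := by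
  rw [Subgroup.isComplement_iff_existsUnique_inv_mul_mem]
  intro g
  refine ⟨⟨(foldOnto p₀ g⁻¹ : G)⁻¹, Set.inv_mem_inv.2 (foldOnto p₀ g⁻¹).2⟩, ?_, ?_⟩
  · have := inv_mem (mul_inv_foldOnto_mem p₀ hS hSR g⁻¹)
    rwa [mul_inv_rev, inv_inv g] at this
  · rintro ⟨j, hj⟩ hjg
    have fold_j : foldOnto p₀ j⁻¹ = ⟨j⁻¹, hj⟩ := hJ ⟨j⁻¹, hj⟩
    have fold_g : foldOnto p₀ g⁻¹ = foldOnto p₀ j⁻¹ := by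
      rw [← foldOnto_mul_left p₀ hR hjg, mul_assoc, mul_inv_cancel, mul_one]
    simp [fold_g, fold_j]

end Fold

section Wedge

/-- The determinant of the matrix with columns `v` and `w`. -/
def wedge (v w : Fin 2 → ℤ) : ℤ := v 0 * w 1 - w 0 * v 1

lemma wedge_swap (v w : Fin 2 → ℤ) : wedge w v = -wedge v w := by simp only [wedge]; ring

lemma wedge_self (v : Fin 2 → ℤ) : wedge v v = 0 := sub_self _

lemma wedge_neg_left (v w : Fin 2 → ℤ) : wedge (-v) w = -wedge v w := by
  simp only [wedge, Pi.neg_apply]; ring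

lemma wedge_neg_right (v w : Fin 2 → ℤ) : wedge v (-w) = -wedge v w := by
  simp only [wedge, Pi.neg_apply]; ring

lemma wedge_sub_left (u v w : Fin 2 → ℤ) : wedge (u - v) w = wedge u w - wedge v w := by
  simp only [wedge, Pi.sub_apply]; ring

lemma wedge_smul_left (c : ℤ) (v w : Fin 2 → ℤ) : wedge (c • v) w = c * wedge v w := by
  simp only [wedge, Pi.smul_apply, smul_eq_mul]; ring

lemma wedge_mul_wedge (u v w y : Fin 2 → ℤ) :
    wedge u v * wedge y w = wedge y v * wedge u w - wedge y u * wedge v w := by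
  simp only [wedge]; ring

lemma wedge_smul_eq (u v y : Fin 2 → ℤ) : wedge u v • y = wedge y v • u - wedge y u • v := by
  refine funext (Fin.forall_fin_two.2 ⟨?_, ?_⟩) <;>
    simp only [wedge, Pi.smul_apply, Pi.sub_apply, smul_eq_mul] <;> ring

lemma eq_or_eq_neg_of_wedge_eq_zero {v w v' w' : Fin 2 → ℤ} (hv : wedge v v' = 1)
    (hw : wedge w' w = 1) (h : wedge v w = 0) : v = w ∨ v = -w := by
  have v_eq : v = wedge w' v • w := by
    have := wedge_smul_eq w' w v
    rw [hw, h, one_smul, zero_smul, zero_sub, ← neg_smul, ← wedge_swap] at this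
    exact this
  have unit : wedge w' v * wedge w v' = 1 := by rw [← wedge_smul_left, ← v_eq, hv]
  obtain h | h := Int.isUnit_iff.1 (IsUnit.of_mul_eq_one _ unit)
  · left; rwa [h, one_smul] at v_eq
  · right; rwa [h, neg_one_smul] at v_eq

/-- The matrix with columns `v` and `w`, as an element of `SL(2, ℤ)`. -/
def ofCols (v w : Fin 2 → ℤ) (h : wedge v w = 1) : SL(2, ℤ) :=
  ⟨!![v 0, w 0; v 1, w 1], by rwa [Matrix.det_fin_two_of]⟩

variable {v w : Fin 2 → ℤ} (h : wedge v w = 1)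

lemma ofCols_col_zero : (ofCols v w h).1.col 0 = v := by ext i; fin_cases i <;> rfl

lemma ofCols_col_one : (ofCols v w h).1.col 1 = w := by ext i; fin_cases i <;> rfl

lemma wedge_col (g : SL(2, ℤ)) : wedge (g.1.col 0) (g.1.col 1) = 1 :=
  (Matrix.det_fin_two g.1).symm.trans g.det_coe

lemma ext_col {g h : SL(2, ℤ)} (h0 : g.1.col 0 = h.1.col 0) (h1 : g.1.col 1 = h.1.col 1) :
    g = h := by
  ext i j
  fin_cases j
  exacts [congrFun h0 i, congrFun h1 i]

lemma neg_col (g : SL(2, ℤ)) (j : Fin 2) : (-g).1.col j = -g.1.col j := by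
  ext i; simp

lemma mul_S_col_zero (g : SL(2, ℤ)) : (g * ModularGroup.S).1.col 0 = g.1.col 1 := by
  ext i; simp [Matrix.mul_apply, ModularGroup.coe_S]

lemma mul_S_col_one (g : SL(2, ℤ)) : (g * ModularGroup.S).1.col 1 = -g.1.col 0 := by
  ext i; simp [Matrix.mul_apply, ModularGroup.coe_S]

lemma mul_T_zpow_col_zero (g : SL(2, ℤ)) (j : ℤ) :
    (g * ModularGroup.T ^ j).1.col 0 = g.1.col 0 := by
  ext i; simp [Matrix.mul_apply, ModularGroup.coe_T_zpow]

lemma mul_T_zpow_col_one (g : SL(2, ℤ)) (j : ℤ) :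
    (g * ModularGroup.T ^ j).1.col 1 = j • g.1.col 0 + g.1.col 1 := by
  ext i; simp [Matrix.mul_apply, ModularGroup.coe_T_zpow, mul_comm]

lemma mul_TS_col_zero (g : SL(2, ℤ)) :
    (g * (ModularGroup.T * ModularGroup.S)).1.col 0 = g.1.col 0 + g.1.col 1 := by
  rw [← mul_assoc, mul_S_col_zero, ← zpow_one ModularGroup.T, mul_T_zpow_col_one, one_smul]

lemma mul_TS_col_one (g : SL(2, ℤ)) :
    (g * (ModularGroup.T * ModularGroup.S)).1.col 1 = -g.1.col 0 := by
  rw [← mul_assoc, mul_S_col_one, ← zpow_one ModularGroup.T, mul_T_zpow_col_zero]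

end Wedge

/-- An ideal polygon with `N` sides whose sides are edges of the Farey tessellation. Its vertices
are the rays spanned by integral vectors, indexed by `ℤ` so that passing once around the polygon
changes the sign of the vector. -/
structure FareyCycle (N : ℕ) where
  vertex : ℤ → Fin 2 → ℤ
  antiperiodic : Function.Antiperiodic vertex N
  wedge_succ : ∀ k : ℤ, wedge (vertex (k + 1)) (vertex k) = 1
  wedge_pos : ∀ k m : ℤ, k < m → m < k + N → 0 < wedge (vertex m) (vertex k)

noncomputable section FareyCycle

namespace FareyCycle

variable {N : ℕ} (C : FareyCycle N)

/-- `v` is, up to sign, one of the vectors that represent the vertices of the polygon. -/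
def IsVertex (v : Fin 2 → ℤ) : Prop := ∃ m, v = C.vertex m

/-- The number of Farey triangles of the polygon that meet at the `k`-th vertex. -/
def fan (k : ℤ) : ℤ := wedge (C.vertex (k + 1)) (C.vertex (k - 1))

variable {C} in
lemma IsVertex.neg {v : Fin 2 → ℤ} (hv : C.IsVertex v) : C.IsVertex (-v) := by
  obtain ⟨m, rfl⟩ := hv
  exact ⟨m + N, (C.antiperiodic m).symm⟩

lemma isVertex_neg_iff {v : Fin 2 → ℤ} : C.IsVertex (-v) ↔ C.IsVertex v :=
  ⟨fun hv => neg_neg v ▸ hv.neg, IsVertex.neg⟩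

lemma isVertex_vertex (m : ℤ) : C.IsVertex (C.vertex m) := ⟨m, rfl⟩

lemma wedge_pred (k : ℤ) : wedge (C.vertex k) (C.vertex (k - 1)) = 1 := by
  simpa using C.wedge_succ (k - 1)

lemma wedge_nonneg {k m : ℤ} (hkm : k ≤ m) (hmk : m ≤ k + N) :
    0 ≤ wedge (C.vertex m) (C.vertex k) := by
  obtain rfl | hkm := hkm.eq_or_lt
  · rw [wedge_self]
  obtain rfl | hmk := hmk.eq_or_lt
  · rw [C.antiperiodic, wedge_neg_left, wedge_self, neg_zero]
  · exact (C.wedge_pos k m hkm hmk).le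

include C in
lemma two_le : 2 ≤ N := by
  by_contra! hN
  have h := C.wedge_succ 0
  have h_anti := C.antiperiodic 0
  interval_cases N
  · have h0 : C.vertex 0 = 0 := by simpa [self_eq_neg] using h_anti
    simp [h0, wedge] at h
  · rw [Nat.cast_one] at h_anti
    rw [h_anti, wedge_neg_left, wedge_self] at h
    simp at h

lemma vertex_add_one_add_vertex_sub_one (k : ℤ) :
    C.vertex (k + 1) + C.vertex (k - 1) = C.fan k • C.vertex k := by
  have := wedge_smul_eq (C.vertex (k + 1)) (C.vertex (k - 1)) (C.vertex k)
  rw [wedge_pred, wedge_swap (C.vertex (k + 1)), wedge_succ, one_smul, neg_one_smul,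
    sub_neg_eq_add] at this
  exact this.symm

lemma fan_nonneg (k : ℤ) : 0 ≤ C.fan k :=
  C.wedge_nonneg (by lia) (by have := C.two_le; lia)

lemma fan_pos (hN : 2 < N) (k : ℤ) : 0 < C.fan k :=
  C.wedge_pos _ _ (by lia) (by lia)

lemma fan_eq_zero (C : FareyCycle 2) (k : ℤ) : C.fan k = 0 := by
  have h := C.antiperiodic (k - 1)
  rw [show k - 1 + (2 : ℕ) = k + 1 by push_cast; ring] at h
  rw [fan, h, wedge_neg_left, wedge_self, neg_zero]

lemma periodic_fan : Function.Periodic C.fan N := fun k => by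
  rw [fan, add_right_comm, add_sub_right_comm, C.antiperiodic, C.antiperiodic, wedge_neg_left,
    wedge_neg_right, neg_neg, fan]

lemma exists_mem_Ico_vertex_eq (k m : ℤ) :
    ∃ i ∈ Set.Ico k (k + N), C.vertex m = C.vertex i ∨ C.vertex m = -C.vertex i := by
  have periodic_pair : Function.Periodic
      (fun i => ({C.vertex i, -C.vertex i} : Set (Fin 2 → ℤ))) N := fun i => by
    simp only [C.antiperiodic i, neg_neg, Set.pair_comm]
  obtain ⟨i, hi, h⟩ := periodic_pair.exists_mem_Ico (by have := C.two_le; lia) m k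
  exact ⟨i, hi, h.le (Set.mem_insert _ _)⟩

lemma isVertex_of_wedge_eq_zero {v w : Fin 2 → ℤ} (hvw : wedge v w = 1) {m : ℤ}
    (h : wedge v (C.vertex m) = 0) : C.IsVertex v := by
  obtain rfl | rfl := eq_or_eq_neg_of_wedge_eq_zero hvw (C.wedge_succ m) h
  exacts [C.isVertex_vertex m, (C.isVertex_vertex m).neg]

/- Otherwise the geodesic from `v` to the `k`-th vertex, an edge of the Farey tessellation, would
cross the side of the polygon between two vertices on different sides of it. -/
lemma isVertex_of_wedge_nonneg {v : Fin 2 → ℤ} {k : ℤ} (hv : wedge v (C.vertex k) = 1)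
    (h_succ : 0 ≤ wedge v (C.vertex (k + 1))) (h_pred : 0 ≤ wedge v (C.vertex (k - 1))) :
    C.IsVertex v := by
  by_contra not_isVertex
  have ne_zero (m : ℤ) : wedge v (C.vertex m) ≠ 0 :=
    fun h => not_isVertex (C.isVertex_of_wedge_eq_zero hv h)
  have pos_of_le (m : ℤ) (hkm : k + 1 ≤ m) : m < k + N → 0 < wedge v (C.vertex m) := by
    induction m, hkm using Int.leInduction with
    | base => exact fun _ => h_succ.lt_of_ne' (ne_zero _)
    | succ m hkm ih =>
      intro hmk
      by_contra! h_le
      have h_lt : wedge v (C.vertex (m + 1)) < 0 := h_le.lt_of_ne (ne_zero _)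
      have h_pos := ih (by lia)
      have m_pos := C.wedge_pos k m (by lia) (by lia)
      have m_succ_pos := C.wedge_pos k (m + 1) (by lia) hmk
      have h_one := wedge_mul_wedge (C.vertex (m + 1)) (C.vertex m) (C.vertex k) v
      rw [C.wedge_succ, hv] at h_one
      nlinarith
  have h_last := pos_of_le (k - 1 + N) (by have := C.two_le; lia) (by lia)
  rw [C.antiperiodic, wedge_neg_right] at h_last
  lia

lemma isVertex_iff_of_wedge_eq_one {v : Fin 2 → ℤ} {k : ℤ} (hv : wedge v (C.vertex k) = 1) :
    C.IsVertex v ↔ 0 ≤ wedge v (C.vertex (k + 1)) ∧ 0 ≤ wedge v (C.vertex (k - 1)) := by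
  refine ⟨?_, fun h => C.isVertex_of_wedge_nonneg hv h.1 h.2⟩
  rintro ⟨m, rfl⟩
  obtain ⟨i, ⟨hki, hik⟩, h | h⟩ := C.exists_mem_Ico_vertex_eq k m <;> rw [h] at hv ⊢
  · obtain rfl | hki := hki.eq_or_lt
    · simp [wedge_self] at hv
    · exact ⟨C.wedge_nonneg (by lia) (by lia), C.wedge_nonneg (by lia) (by lia)⟩
  · rw [wedge_neg_left] at hv
    linarith [C.wedge_nonneg hki hik.le]

lemma isVertex_smul_sub_iff (k j : ℤ) :
    C.IsVertex (j • C.vertex k - C.vertex (k + 1)) ↔ 0 ≤ j ∧ j ≤ C.fan k := by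
  have wedge_eq (u : Fin 2 → ℤ) : wedge (C.vertex (k + 1) - j • C.vertex k) u =
      wedge (C.vertex (k + 1)) u - j * wedge (C.vertex k) u := by
    rw [wedge_sub_left, wedge_smul_left]
  rw [← isVertex_neg_iff, neg_sub, C.isVertex_iff_of_wedge_eq_one (k := k), wedge_eq, wedge_eq,
    wedge_self, wedge_swap (C.vertex (k + 1)) (C.vertex k), C.wedge_succ, C.wedge_pred, ← fan]
  · lia
  · rw [wedge_eq, wedge_self, C.wedge_succ, mul_zero, sub_zero]

end FareyCycle

end FareyCycle

noncomputable section FareyCorners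

namespace FareyCycle

variable {N : ℕ} (C : FareyCycle N)

/-- The matrix that takes `∞` to the `k`-th and `0` to the next vertex. -/
def corner (k : ℤ) : SL(2, ℤ) :=
  ofCols (C.vertex k) (-C.vertex (k + 1)) (by
    rw [wedge_neg_right, ← wedge_swap, C.wedge_succ])

/-- The matrix that takes `0` to the `k`-th and `∞` to the next vertex: the oriented side. -/
def edge (k : ℤ) : SL(2, ℤ) := ofCols (C.vertex (k + 1)) (C.vertex k) (C.wedge_succ k)

/-- `g` takes `0` and `∞` to vertices. -/
def IsEdge (g : SL(2, ℤ)) : Prop := C.IsVertex (g.1.col 0) ∧ C.IsVertex (g.1.col 1)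

/-- `g` takes the Farey triangle with the vertices `0`, `1`, `∞` to one with vertices of the
polygon. -/
def IsInner (g : SL(2, ℤ)) : Prop := C.IsEdge g ∧ C.IsVertex (g.1.col 0 + g.1.col 1)

lemma edge_mul_S (k : ℤ) : C.edge k * ModularGroup.S = C.corner k := by
  apply ext_col
  · rw [mul_S_col_zero, edge, corner, ofCols_col_one, ofCols_col_zero]
  · rw [mul_S_col_one, edge, corner, ofCols_col_zero, ofCols_col_one]

lemma corner_mul_T_zpow_col_zero (k j : ℤ) :
    (C.corner k * ModularGroup.T ^ j).1.col 0 = C.vertex k := by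
  rw [mul_T_zpow_col_zero, corner, ofCols_col_zero]

lemma corner_mul_T_zpow_col_one (k j : ℤ) :
    (C.corner k * ModularGroup.T ^ j).1.col 1 = j • C.vertex k - C.vertex (k + 1) := by
  rw [mul_T_zpow_col_one, corner, ofCols_col_zero, ofCols_col_one, sub_eq_add_neg]

lemma corner_mul_T_fan (k : ℤ) : C.corner k * ModularGroup.T ^ C.fan k = C.edge (k - 1) := by
  apply ext_col
  · rw [corner_mul_T_zpow_col_zero, edge, ofCols_col_zero, sub_add_cancel]
  · rw [corner_mul_T_zpow_col_one, edge, ofCols_col_one, sub_eq_iff_eq_add',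
      vertex_add_one_add_vertex_sub_one]

lemma isEdge_iff (g : SL(2, ℤ)) :
    C.IsEdge g ↔ ∃ k j : ℤ, 0 ≤ j ∧ j ≤ C.fan k ∧ g = C.corner k * ModularGroup.T ^ j := by
  constructor
  · rintro ⟨⟨k, hk⟩, h⟩
    have col_one_eq :
        g.1.col 1 = wedge (C.vertex (k + 1)) (g.1.col 1) • C.vertex k - C.vertex (k + 1) := by
      have := wedge_smul_eq (C.vertex (k + 1)) (C.vertex k) (g.1.col 1)
      rw [C.wedge_succ, ← hk, wedge_swap (g.1.col 0), wedge_col, hk, wedge_swap _ (g.1.col 1),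
        one_smul, neg_one_smul, neg_smul, sub_neg_eq_add, neg_add_eq_sub] at this
      exact this
    rw [col_one_eq, isVertex_smul_sub_iff] at h
    refine ⟨k, _, h.1, h.2, ext_col ?_ ?_⟩
    · rw [corner_mul_T_zpow_col_zero, hk]
    · rw [corner_mul_T_zpow_col_one, ← col_one_eq]
  · rintro ⟨k, j, h0, hj, rfl⟩
    rw [IsEdge, corner_mul_T_zpow_col_zero, corner_mul_T_zpow_col_one, isVertex_smul_sub_iff]
    exact ⟨C.isVertex_vertex k, h0, hj⟩

lemma isInner_corner_iff (k j : ℤ) :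
    C.IsInner (C.corner k * ModularGroup.T ^ j) ↔ 0 ≤ j ∧ j < C.fan k := by
  have sum_eq : C.vertex k + (j • C.vertex k - C.vertex (k + 1)) =
      (j + 1) • C.vertex k - C.vertex (k + 1) := by
    rw [add_smul, one_smul]; abel
  rw [IsInner, IsEdge, corner_mul_T_zpow_col_zero, corner_mul_T_zpow_col_one, sum_eq,
    isVertex_smul_sub_iff, isVertex_smul_sub_iff, and_iff_right (C.isVertex_vertex k)]
  lia

variable {C}

lemma IsEdge.isInner_or_eq_edge {g : SL(2, ℤ)} (hg : C.IsEdge g) :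
    C.IsInner g ∨ ∃ k, g = C.edge k := by
  obtain ⟨k, j, h0, hj, rfl⟩ := (C.isEdge_iff g).1 hg
  obtain hj | rfl := hj.lt_or_eq
  · exact Or.inl ((C.isInner_corner_iff k j).2 ⟨h0, hj⟩)
  · exact Or.inr ⟨k - 1, C.corner_mul_T_fan k⟩

lemma IsEdge.mul_S {g : SL(2, ℤ)} (hg : C.IsEdge g) : C.IsEdge (g * ModularGroup.S) := by
  rw [IsEdge, mul_S_col_zero, mul_S_col_one]
  exact ⟨hg.2, hg.1.neg⟩

lemma IsInner.mul_TS {g : SL(2, ℤ)} (hg : C.IsInner g) :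
    C.IsInner (g * (ModularGroup.T * ModularGroup.S)) := by
  rw [IsInner, IsEdge, mul_TS_col_zero, mul_TS_col_one, add_neg_cancel_comm]
  exact ⟨⟨hg.2, hg.1.1.neg⟩, hg.1.2⟩

lemma IsInner.neg {g : SL(2, ℤ)} (hg : C.IsInner g) : C.IsInner (-g) := by
  rw [IsInner, IsEdge, neg_col, neg_col, ← neg_add]
  exact ⟨⟨hg.1.1.neg, hg.1.2.neg⟩, hg.2.neg⟩

variable (C)

lemma isEdge_edge (k : ℤ) : C.IsEdge (C.edge k) := by
  rw [IsEdge, edge, ofCols_col_zero, ofCols_col_one]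
  exact ⟨C.isVertex_vertex _, C.isVertex_vertex _⟩

lemma not_isInner_edge (k : ℤ) : ¬ C.IsInner (C.edge k) := by
  rw [← add_sub_cancel_right k 1, ← corner_mul_T_fan, isInner_corner_iff]
  exact fun h => h.2.false

/-- The set of classes of matrices that take the Farey triangle with the vertices `0`, `1`, `∞`
to a triangle of the polygon. -/
def inner : Set PSL(2, ℤ) := {g | ∃ h, C.IsInner h ∧ g = QuotientGroup.mk h}

/-- The class of the matrix of an oriented side. -/
def pslEdge (k : ℤ) : PSL(2, ℤ) := QuotientGroup.mk (C.edge k)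

/-- The class of the matrix that takes `∞` to the `k`-th vertex and `0` to the vertex reached from
the next one by crossing `j` triangles at the `k`-th vertex. -/
def pslCorner (k j : ℤ) : PSL(2, ℤ) := QuotientGroup.mk (C.corner k * ModularGroup.T ^ j)

lemma mk_mem_inner_iff (g : SL(2, ℤ)) :
    (QuotientGroup.mk g : PSL(2, ℤ)) ∈ C.inner ↔ C.IsInner g := by
  constructor
  · rintro ⟨h, hh, hgh⟩
    obtain rfl | rfl := (psl_mk_eq_mk_iff _ _).1 hgh
    exacts [hh, hh.neg]
  · exact fun hg => ⟨g, hg, rfl⟩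

lemma mul_pslU_mem_inner {g : PSL(2, ℤ)} (hg : g ∈ C.inner) : g * pslU ∈ C.inner := by
  obtain ⟨h, hh, rfl⟩ := hg
  exact ⟨_, hh.mul_TS, rfl⟩

lemma pslCorner_mem_inner_iff (k j : ℤ) : C.pslCorner k j ∈ C.inner ↔ 0 ≤ j ∧ j < C.fan k := by
  rw [pslCorner, mk_mem_inner_iff, isInner_corner_iff]

lemma pslEdge_notMem_inner (k : ℤ) : C.pslEdge k ∉ C.inner := by
  rw [pslEdge, mk_mem_inner_iff]
  exact C.not_isInner_edge k

lemma mem_inner_iff (g : PSL(2, ℤ)) :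
    g ∈ C.inner ↔ ∃ k j : ℤ, 0 ≤ j ∧ j < C.fan k ∧ g = C.pslCorner k j := by
  constructor
  · rintro ⟨h, hh, rfl⟩
    obtain ⟨k, j, h0, -, rfl⟩ := (C.isEdge_iff h).1 hh.1
    exact ⟨k, j, h0, ((C.isInner_corner_iff k j).1 hh).2, rfl⟩
  · rintro ⟨k, j, h0, hj, rfl⟩
    exact (C.pslCorner_mem_inner_iff k j).2 ⟨h0, hj⟩

lemma mul_pslS_mem_inner_union_range {g : PSL(2, ℤ)} (hg : g ∈ C.inner ∪ Set.range C.pslEdge) :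
    g * pslS ∈ C.inner ∪ Set.range C.pslEdge := by
  obtain ⟨h, hh, rfl⟩ : ∃ h, C.IsEdge h ∧ g = QuotientGroup.mk h := by
    obtain ⟨h, hh, rfl⟩ | ⟨k, rfl⟩ := hg
    exacts [⟨h, hh.1, rfl⟩, ⟨_, C.isEdge_edge k, rfl⟩]
  obtain hS | ⟨k, hk⟩ := hh.mul_S.isInner_or_eq_edge
  · exact Or.inl ⟨_, hS, rfl⟩
  · exact Or.inr ⟨k, congrArg QuotientGroup.mk hk.symm⟩

lemma pslCorner_add_one (k j : ℤ) : C.pslCorner k (j + 1) = C.pslCorner k j * pslU * pslS := by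
  rw [pslCorner, zpow_add_one, ← mul_assoc, QuotientGroup.mk_mul, mk_T_eq, ← mul_assoc, pslCorner]

lemma pslCorner_fan (k : ℤ) : C.pslCorner k (C.fan k) = C.pslEdge (k - 1) := by
  rw [pslCorner, corner_mul_T_fan, pslEdge]

lemma pslEdge_mul_pslS (k : ℤ) : C.pslEdge k * pslS = C.pslCorner k 0 := by
  rw [pslEdge, pslS, ← QuotientGroup.mk_mul, edge_mul_S, pslCorner, zpow_zero, mul_one]

lemma periodic_pslEdge : Function.Periodic C.pslEdge N := fun k => by
  refine (psl_mk_eq_mk_iff _ _).2 (Or.inr (ext_col ?_ ?_))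
  · rw [neg_col, edge, edge, ofCols_col_zero, ofCols_col_zero, add_right_comm, C.antiperiodic]
  · rw [neg_col, edge, edge, ofCols_col_one, ofCols_col_one, C.antiperiodic]

lemma pslCorner_eq (k j : ℤ) :
    C.pslCorner k j = C.pslEdge k * pslS * QuotientGroup.mk (ModularGroup.T ^ j) := by
  rw [pslCorner, QuotientGroup.mk_mul, pslEdge_mul_pslS, pslCorner, zpow_zero, mul_one]

lemma periodic_pslCorner (j : ℤ) : Function.Periodic (C.pslCorner · j) N := fun k => by
  simp only [pslCorner_eq, C.periodic_pslEdge k]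

lemma injOn_pslEdge (a : ℤ) : Set.InjOn C.pslEdge (Set.Ico a (a + N)) := by
  suffices h_lt : ∀ k ∈ Set.Ico a (a + N), ∀ m ∈ Set.Ico a (a + N), k < m →
      C.pslEdge k ≠ C.pslEdge m by
    intro k hk m hm h
    by_contra h_ne
    obtain hkm | hmk := lt_or_gt_of_ne h_ne
    exacts [h_lt k hk m hm hkm h, h_lt m hm k hk hmk h.symm]
  intro k hk m hm hkm h
  have h_pos := C.wedge_pos k m hkm (by have := hk.1; have := hm.2; lia)
  have col_edge (i : ℤ) : (C.edge i).1.col 1 = C.vertex i := by rw [edge, ofCols_col_one]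
  obtain h | h := (psl_mk_eq_mk_iff _ _).1 h
  · rw [← col_edge k, h, col_edge, wedge_self] at h_pos
    exact h_pos.false
  · rw [← col_edge k, h, neg_col, col_edge, wedge_neg_right, wedge_self, neg_zero] at h_pos
    exact h_pos.false

end FareyCycle

end FareyCorners

lemma exists_fin_eq_of_periodic {α : Type*} {N : ℕ} {f : ℤ → α} (hf : Function.Periodic f N)
    (hN : 0 < N) (m : ℤ) : ∃ k : Fin N, f m = f k := by
  obtain ⟨i, ⟨hi, hiN⟩, h⟩ := hf.exists_mem_Ico₀ (by lia) m
  lift i to ℕ using hi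
  exact ⟨⟨i, by lia⟩, h⟩

lemma intCast_fin_sub_one {N : ℕ} [NeZero N] (hN : 2 ≤ N) (k : Fin N) :
    ((k - 1 : Fin N) : ℤ) = k - 1 ∨ ((k - 1 : Fin N) : ℤ) = k - 1 + N := by
  have one_mod : 1 % N = 1 := Nat.mod_eq_of_lt hN
  rw [Fin.intCast_val_sub_eq_sub_add_ite, Fin.val_one', one_mod, Nat.cast_one]
  split_ifs
  · exact Or.inl (add_zero _)
  · exact Or.inr rfl

namespace FareyCycle

variable {N : ℕ} (C : FareyCycle N)

lemma pslEdge_injective : Function.Injective fun k : Fin N => C.pslEdge k := fun k m h =>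
  Fin.ext <| Int.natCast_inj.1 <|
    C.injOn_pslEdge 0 (by simp) (by simp) h

lemma pslEdge_mul_pslS_of_ne (hN : N = 2) {k m : Fin N} (hkm : k ≠ m) :
    C.pslEdge k * pslS = C.pslEdge m := by
  subst hN
  have hk := C.pslCorner_fan k
  rw [C.fan_eq_zero] at hk
  rw [C.pslEdge_mul_pslS, hk]
  fin_cases k <;> fin_cases m
  exacts [absurd rfl hkm, (C.periodic_pslEdge (-1)).symm, rfl, absurd rfl hkm]

lemma pslCorner_fan_eq_pslEdge_sub_one [NeZero N] (k : Fin N) :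
    C.pslCorner k (C.fan k) = C.pslEdge (k - 1 : Fin N) := by
  obtain h | h := intCast_fin_sub_one C.two_le k
  · rw [C.pslCorner_fan, h]
  · rw [C.pslCorner_fan, h, C.periodic_pslEdge]

lemma fan_eq_abs [NeZero N] (k : Fin N) :
    C.fan k = |wedge (C.vertex (k - 1 : Fin N)) (C.vertex (k + 1))| := by
  obtain h | h := intCast_fin_sub_one C.two_le k
  · rw [h, wedge_swap, abs_neg, ← fan, abs_of_nonneg (C.fan_nonneg k)]
  · rw [h, C.antiperiodic, wedge_neg_left, ← wedge_swap, ← fan, abs_of_nonneg (C.fan_nonneg k)]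

end FareyCycle

/-- The combinatorial data of a side pairing of a polygon with `N` boundary pieces: the pieces
that carry an odd pairing, and a partner for each of the others. An even pairing is encoded as a
piece that is its own partner. A bigon has an odd piece, as it has no interior otherwise. -/
structure SideGluing (N : ℕ) where
  IsOdd : Fin N → Prop
  partner : Fin N → Fin N
  partner_partner : ∀ k, partner (partner k) = k
  not_isOdd_partner : ∀ k, ¬ IsOdd k → ¬ IsOdd (partner k)
  exists_isOdd : N = 2 → ∃ k, IsOdd k

noncomputable section SideGluing

namespace SideGluing

variable {N : ℕ} (G : SideGluing N) (C : FareyCycle N)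

/-- The group elements that correspond to the pieces of the polygon: one third of each Farey
triangle of the polygon for each of its vertices, and one such third beyond each odd side. -/
def tiles : Set PSL(2, ℤ) := C.inner ∪ (fun k : Fin N => C.pslEdge k) '' {k | G.IsOdd k}

/-- The side pairing transformations. -/
def pairings : Set PSL(2, ℤ) :=
  {γ | ∃ k : Fin N,
    (¬ G.IsOdd k ∧ γ = C.pslEdge (G.partner k) * pslS * (C.pslEdge k)⁻¹) ∨
    (G.IsOdd k ∧ γ = C.pslEdge k * pslU * (C.pslEdge k)⁻¹)}

lemma pslEdge_mem_tiles_iff (k : Fin N) : C.pslEdge k ∈ G.tiles C ↔ G.IsOdd k := by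
  rw [tiles, Set.mem_union, or_iff_right (C.pslEdge_notMem_inner k)]
  exact C.pslEdge_injective.mem_set_image

lemma mul_pslS_mem_tiles_or {p : PSL(2, ℤ)} (hp : p ∈ G.tiles C) :
    p * pslS ∈ G.tiles C ∨ ∃ k : Fin N, ¬ G.IsOdd k ∧ p = C.pslEdge k * pslS := by
  have hpS : p * pslS ∈ C.inner ∪ Set.range C.pslEdge := by
    refine C.mul_pslS_mem_inner_union_range (hp.imp_right ?_)
    rintro ⟨k, -, rfl⟩
    exact ⟨k, rfl⟩
  obtain hpS | ⟨m, hm⟩ := hpS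
  · exact Or.inl (Or.inl hpS)
  obtain ⟨k, hk⟩ := exists_fin_eq_of_periodic C.periodic_pslEdge (by have := C.two_le; lia) m
  rw [hk] at hm
  by_cases h_odd : G.IsOdd k
  · exact Or.inl (hm ▸ (G.pslEdge_mem_tiles_iff C k).2 h_odd)
  · exact Or.inr ⟨k, h_odd, by rw [hm, mul_assoc, pslS_mul_self, mul_one]⟩

lemma pslEdge_mul_pslS_mem_tiles {k : Fin N} (hk : ¬ G.IsOdd k) :
    C.pslEdge k * pslS ∈ G.tiles C := by
  obtain rfl | hN := C.two_le.eq_or_lt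
  · obtain ⟨m, hm⟩ := G.exists_isOdd rfl
    rw [C.pslEdge_mul_pslS_of_ne rfl fun h : k = m => hk (h ▸ hm)]
    exact (G.pslEdge_mem_tiles_iff C m).2 hm
  · left
    rw [C.pslEdge_mul_pslS, C.pslCorner_mem_inner_iff]
    exact ⟨le_rfl, C.fan_pos hN _⟩

lemma tiles_induction_of_bigon (G : SideGluing 2) (C : FareyCycle 2) {k : Fin 2}
    {motive : PSL(2, ℤ) → Prop} (base : motive (C.pslEdge k))
    (mul_pslS : ∀ p, p * pslS ∈ G.tiles C → motive p → motive (p * pslS)) {p : PSL(2, ℤ)}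
    (hp : p ∈ G.tiles C) : motive p := by
  obtain hp_inner | ⟨m, hm, rfl⟩ := id hp
  · obtain ⟨i, j, h0, hj, -⟩ := (C.mem_inner_iff p).1 hp_inner
    rw [C.fan_eq_zero] at hj
    exact absurd h0 hj.not_ge
  · obtain rfl | hkm := eq_or_ne k m
    · exact base
    · dsimp only at hp ⊢
      rw [← C.pslEdge_mul_pslS_of_ne rfl hkm] at hp ⊢
      exact mul_pslS _ hp base

lemma exists_pslCorner_of_mem_tiles {p : PSL(2, ℤ)} (hp : p ∈ G.tiles C) :
    ∃ k j : ℤ, 0 ≤ j ∧ j ≤ C.fan k ∧ p = C.pslCorner k j := by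
  obtain hp | ⟨k, -, rfl⟩ := hp
  · obtain ⟨k, j, h0, hj, rfl⟩ := (C.mem_inner_iff p).1 hp
    exact ⟨k, j, h0, hj.le, rfl⟩
  · exact ⟨k + 1, _, C.fan_nonneg _, le_rfl, by rw [C.pslCorner_fan, add_sub_cancel_right]⟩

lemma tiles_induction_of_two_lt (hN : 2 < N) {motive : PSL(2, ℤ) → Prop}
    (base : motive (C.pslCorner 0 0))
    (mul_pslS : ∀ p, p * pslS ∈ G.tiles C → motive p → motive (p * pslS))
    (mul_pslU : ∀ p ∈ C.inner, motive p → motive (p * pslU)) {p : PSL(2, ℤ)}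
    (hp : p ∈ G.tiles C) : motive p := by
  have turn_corner (k j : ℤ) (h0 : 0 ≤ j) : C.pslCorner k j ∈ G.tiles C → j ≤ C.fan k →
      motive (C.pslCorner k 0) → motive (C.pslCorner k j) := by
    induction j, h0 using Int.leInduction with
    | base => exact fun _ _ hk => hk
    | succ j h0 ih =>
      intro h_mem hj hk
      have h_inner := (C.pslCorner_mem_inner_iff k j).2 ⟨h0, by lia⟩
      rw [C.pslCorner_add_one] at h_mem ⊢
      exact mul_pslS _ h_mem (mul_pslU _ h_inner (ih (Or.inl h_inner) (by lia) hk))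
  have prev_corner (k : ℤ) (hk : motive (C.pslCorner k 0)) : motive (C.pslCorner (k - 1) 0) := by
    have fan_pos := C.fan_pos hN k
    have last_inner := (C.pslCorner_mem_inner_iff k (C.fan k - 1)).2 ⟨by lia, by lia⟩
    have last_mul_pslU : C.pslCorner k (C.fan k - 1) * pslU = C.pslCorner (k - 1) 0 := by
      rw [← C.pslEdge_mul_pslS, ← C.pslCorner_fan, ← sub_add_cancel (C.fan k) 1,
        C.pslCorner_add_one, sub_add_cancel, mul_assoc _ pslS, pslS_mul_self, mul_one]
    rw [← last_mul_pslU]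
    exact mul_pslU _ last_inner (turn_corner k _ (by lia) (Or.inl last_inner) (by lia) hk)
  have corner_zero (k : ℤ) : motive (C.pslCorner k 0) := by
    obtain ⟨i, ⟨-, hi⟩, hki⟩ := (C.periodic_pslCorner 0).exists_mem_Ico (by lia) k (-N)
    replace hi : i ≤ 0 := by lia
    rw [hki]
    clear hki
    induction i, hi using Int.leInductionDown with
    | base => exact base
    | pred i _ ih => exact prev_corner i ih
  obtain ⟨k, j, h0, hj, rfl⟩ := G.exists_pslCorner_of_mem_tiles C hp
  exact turn_corner k j h0 hp hj (corner_zero k)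

lemma exists_tiles_induction : ∃ p₀ : G.tiles C, ∀ motive : PSL(2, ℤ) → Prop, motive p₀ →
    (∀ p, p * pslS ∈ G.tiles C → motive p → motive (p * pslS)) →
    (∀ p ∈ C.inner, motive p → motive (p * pslU)) → ∀ p ∈ G.tiles C, motive p := by
  obtain rfl | hN := C.two_le.eq_or_lt
  · obtain ⟨k, hk⟩ := G.exists_isOdd rfl
    exact ⟨⟨_, (G.pslEdge_mem_tiles_iff C k).2 hk⟩, fun _ base mul_pslS _ _ =>
      G.tiles_induction_of_bigon C base mul_pslS⟩
  · exact ⟨⟨_, Or.inl ((C.pslCorner_mem_inner_iff 0 0).2 ⟨le_rfl, C.fan_pos hN 0⟩)⟩,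
      fun _ base mul_pslS mul_pslU _ => G.tiles_induction_of_two_lt C hN base mul_pslS mul_pslU⟩

/-- The tile reached from `p` by crossing the side that is the image under `p` of the imaginary
axis; a side of the polygon leads to its partner. -/
def cross : PSL(2, ℤ) → PSL(2, ℤ) :=
  Function.extend (fun k : {k // ¬ G.IsOdd k} => C.pslEdge k * pslS)
    (fun k => C.pslEdge (G.partner k) * pslS) (· * pslS)

open Classical in
/-- The tile reached from `p` by turning about the image under `p` of the elliptic point of order
three; the third of a triangle beyond an odd side is glued to itself there. -/
def turn (p : PSL(2, ℤ)) : PSL(2, ℤ) := if p ∈ C.inner then p * pslU else p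

lemma cross_pslEdge_mul_pslS {k : Fin N} (hk : ¬ G.IsOdd k) :
    G.cross C (C.pslEdge k * pslS) = C.pslEdge (G.partner k) * pslS := by
  have h_inj : Function.Injective fun k : {k // ¬ G.IsOdd k} => C.pslEdge k.1 * pslS :=
    fun _ _ h => Subtype.ext (C.pslEdge_injective (mul_right_cancel h))
  exact h_inj.extend_apply _ _ ⟨k, hk⟩

lemma cross_of_mul_pslS_mem {p : PSL(2, ℤ)} (hp : p * pslS ∈ G.tiles C) :
    G.cross C p = p * pslS := by
  refine Function.extend_apply' _ _ _ ?_
  rintro ⟨⟨k, hk⟩, rfl⟩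
  rw [mul_assoc, pslS_mul_self, mul_one] at hp
  exact hk ((G.pslEdge_mem_tiles_iff C k).1 hp)

lemma cross_mem_tiles {p : PSL(2, ℤ)} (hp : p ∈ G.tiles C) : G.cross C p ∈ G.tiles C := by
  obtain hpS | ⟨k, hk, rfl⟩ := G.mul_pslS_mem_tiles_or C hp
  · rwa [cross_of_mul_pslS_mem G C hpS]
  · rw [cross_pslEdge_mul_pslS G C hk]
    exact G.pslEdge_mul_pslS_mem_tiles C (G.not_isOdd_partner k hk)

lemma cross_cross {p : PSL(2, ℤ)} (hp : p ∈ G.tiles C) : G.cross C (G.cross C p) = p := by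
  obtain hpS | ⟨k, hk, rfl⟩ := G.mul_pslS_mem_tiles_or C hp
  · have hpSS : p * pslS * pslS = p := by rw [mul_assoc, pslS_mul_self, mul_one]
    rw [cross_of_mul_pslS_mem G C hpS, cross_of_mul_pslS_mem G C (by rwa [hpSS]), hpSS]
  · rw [cross_pslEdge_mul_pslS G C hk,
      cross_pslEdge_mul_pslS G C (G.not_isOdd_partner k hk), G.partner_partner]

lemma turn_of_mem_inner {p : PSL(2, ℤ)} (hp : p ∈ C.inner) : turn C p = p * pslU := if_pos hp

lemma turn_of_notMem_inner {p : PSL(2, ℤ)} (hp : p ∉ C.inner) : turn C p = p := if_neg hp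

lemma turn_mem_tiles {p : PSL(2, ℤ)} (hp : p ∈ G.tiles C) : turn C p ∈ G.tiles C := by
  by_cases hp_inner : p ∈ C.inner
  · rw [turn_of_mem_inner C hp_inner]
    exact Or.inl (C.mul_pslU_mem_inner hp_inner)
  · rwa [turn_of_notMem_inner C hp_inner]

lemma turn_turn_turn (p : PSL(2, ℤ)) : turn C (turn C (turn C p)) = p := by
  by_cases hp : p ∈ C.inner
  · have hpU := C.mul_pslU_mem_inner hp
    rw [turn_of_mem_inner C hp, turn_of_mem_inner C hpU,
      turn_of_mem_inner C (C.mul_pslU_mem_inner hpU), mul_assoc, mul_assoc, ← pow_three,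
      pslU_pow_three, mul_one]
  · simp only [turn_of_notMem_inner C hp]

open scoped RightActions

lemma exists_tiles_rightAction : ∃ _ : MulAction PSL(2, ℤ)ᵐᵒᵖ (G.tiles C),
    ∀ p : G.tiles C, ((p <• pslS : G.tiles C) : PSL(2, ℤ)) = G.cross C p ∧
      ((p <• pslU : G.tiles C) : PSL(2, ℤ)) = turn C p := by
  let σ : Equiv.Perm (G.tiles C) := Function.Involutive.toPerm
    (fun p => ⟨G.cross C p, G.cross_mem_tiles C p.2⟩) fun p => Subtype.ext (G.cross_cross C p.2)
  let turnTile (p : G.tiles C) : G.tiles C := ⟨turn C p, G.turn_mem_tiles C p.2⟩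
  have turnTile_cubed (p : G.tiles C) : turnTile (turnTile (turnTile p)) = p :=
    Subtype.ext (turn_turn_turn C p)
  let τ : Equiv.Perm (G.tiles C) :=
    ⟨turnTile, turnTile ∘ turnTile, turnTile_cubed, turnTile_cubed⟩
  obtain ⟨act, h_act⟩ := exists_psl_rightAction (σ := σ) (τ := τ)
    (Equiv.ext fun p => Subtype.ext (G.cross_cross C p.2)) (Equiv.ext turnTile_cubed)
  exact ⟨act, fun p => ⟨congrArg _ (h_act p).1, congrArg _ (h_act p).2⟩⟩

lemma mul_pslS_mul_inv_cross_mem {p : PSL(2, ℤ)} (hp : p ∈ G.tiles C) :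
    p * pslS * (G.cross C p)⁻¹ ∈ Subgroup.closure (G.pairings C) := by
  obtain hpS | ⟨k, hk, rfl⟩ := G.mul_pslS_mem_tiles_or C hp
  · rw [cross_of_mul_pslS_mem G C hpS, mul_inv_cancel]
    exact one_mem _
  · rw [cross_pslEdge_mul_pslS G C hk, mul_assoc (C.pslEdge k), pslS_mul_self, mul_one,
      ← inv_mem_iff, mul_inv_rev, inv_inv]
    exact Subgroup.subset_closure ⟨k, Or.inl ⟨hk, rfl⟩⟩

lemma mul_pslU_mul_inv_turn_mem {p : PSL(2, ℤ)} (hp : p ∈ G.tiles C) :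
    p * pslU * (turn C p)⁻¹ ∈ Subgroup.closure (G.pairings C) := by
  by_cases hp_inner : p ∈ C.inner
  · rw [turn_of_mem_inner C hp_inner, mul_inv_cancel]
    exact one_mem _
  · rw [turn_of_notMem_inner C hp_inner]
    obtain ⟨k, hk, rfl⟩ := hp.resolve_left hp_inner
    exact Subgroup.subset_closure ⟨k, Or.inr ⟨hk, rfl⟩⟩

open scoped Pointwise in
theorem isComplement_inv_tiles :
    Subgroup.IsComplement (G.tiles C)⁻¹ (Subgroup.closure (G.pairings C) : Set PSL(2, ℤ)) := by
  obtain ⟨_, h_act⟩ := G.exists_tiles_rightAction C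
  obtain ⟨p₀, h_ind⟩ := G.exists_tiles_induction C
  have fold_mul_pslS (p : PSL(2, ℤ)) :
      (foldOnto p₀ (p * pslS) : PSL(2, ℤ)) = G.cross C (foldOnto p₀ p) := by
    rw [foldOnto_mul, (h_act _).1]
  have fold_mul_pslU (p : PSL(2, ℤ)) :
      (foldOnto p₀ (p * pslU) : PSL(2, ℤ)) = turn C (foldOnto p₀ p) := by
    rw [foldOnto_mul, (h_act _).2]
  have fold_tile (p : PSL(2, ℤ)) (hp : p ∈ G.tiles C) : (foldOnto p₀ p : PSL(2, ℤ)) = p := by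
    refine h_ind (fun p => (foldOnto p₀ p : PSL(2, ℤ)) = p) ?_ ?_ ?_ p hp
    · rw [foldOnto, inv_mul_cancel, MulOpposite.op_one, one_smul]
    · intro p hpS hp
      rw [fold_mul_pslS, hp, G.cross_of_mul_pslS_mem C hpS]
    · intro p hp_inner hp
      rw [fold_mul_pslU, hp, turn_of_mem_inner C hp_inner]
  refine isComplement_inv_closure_of_foldOnto p₀ closure_pslS_pslU
    (fun p => Subtype.ext (fold_tile p p.2)) ?_ ?_
  · rintro s (rfl | rfl) p
    · rw [(h_act p).1]
      exact G.mul_pslS_mul_inv_cross_mem C p.2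
    · rw [(h_act p).2]
      exact G.mul_pslU_mul_inv_turn_mem C p.2
  · rintro γ ⟨k, ⟨hk, rfl⟩ | ⟨hk, rfl⟩⟩
    · have hk_eq : C.pslEdge k * pslS * pslS = C.pslEdge k := by
        rw [mul_assoc, pslS_mul_self, mul_one]
      refine ⟨C.pslEdge k, Subtype.ext ?_⟩
      rw [inv_mul_cancel_right,
        fold_tile _ (G.pslEdge_mul_pslS_mem_tiles C (G.not_isOdd_partner k hk)), ← hk_eq,
        fold_mul_pslS, fold_tile _ (G.pslEdge_mul_pslS_mem_tiles C hk),
        G.cross_pslEdge_mul_pslS C hk]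
    · refine ⟨C.pslEdge k, Subtype.ext ?_⟩
      rw [inv_mul_cancel_right, fold_mul_pslU,
        fold_tile _ ((G.pslEdge_mem_tiles_iff C k).2 hk),
        turn_of_notMem_inner C (C.pslEdge_notMem_inner k)]

lemma mem_tiles_iff [NeZero N] (g : PSL(2, ℤ)) :
    g ∈ G.tiles C ↔ ∃ k : Fin N, ∃ j : ℤ, 0 ≤ j ∧
      (j < C.fan k ∨ j = C.fan k ∧ G.IsOdd (k - 1)) ∧ g = C.pslCorner k j := by
  constructor
  · rintro (hg | ⟨k, hk, rfl⟩)
    · obtain ⟨i, h⟩ := (C.mem_inner_iff g).1 hg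
      have periodic_corners : Function.Periodic
          (fun i => ∃ j : ℤ, 0 ≤ j ∧ j < C.fan i ∧ g = C.pslCorner i j) N := fun i => by
        simp only [C.periodic_fan i, fun j => C.periodic_pslCorner j i]
      obtain ⟨k, hk⟩ := exists_fin_eq_of_periodic periodic_corners (NeZero.pos N) i
      obtain ⟨j, h0, hj, rfl⟩ := hk.mp h
      exact ⟨k, j, h0, Or.inl hj, rfl⟩
    · refine ⟨k + 1, _, C.fan_nonneg _, Or.inr ⟨rfl, ?_⟩, ?_⟩
      · rwa [add_sub_cancel_right]
      · rw [C.pslCorner_fan_eq_pslEdge_sub_one, add_sub_cancel_right]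
  · rintro ⟨k, j, h0, hj | ⟨rfl, hk⟩, rfl⟩
    · exact Or.inl ((C.pslCorner_mem_inner_iff k j).2 ⟨h0, hj⟩)
    · rw [C.pslCorner_fan_eq_pslEdge_sub_one, pslEdge_mem_tiles_iff]
      exact hk

end SideGluing

end SideGluing

section ExtPoint

open ModularGroup
open scoped UpperHalfPlane

lemma cuspMove_mul (g h : SL(2, ℤ)) (c : OnePoint ℚ) :
    cuspMove (g * h) c = cuspMove g (cuspMove h c) := by
  rw [cuspMove, map_mul, mul_smul, ← cuspMove, ← cuspMove]

lemma cuspMove_one (c : OnePoint ℚ) : cuspMove 1 c = c := by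
  rw [cuspMove, map_one, one_smul]

lemma cuspMove_neg (g : SL(2, ℤ)) (c : OnePoint ℚ) : cuspMove (-g) c = cuspMove g c := by
  obtain ⟨h, rfl⟩ := c.exists_mem_SL2 ℤ
  rw [← cuspMove, ← cuspMove_mul, ← cuspMove_mul, neg_mul, cuspMove_infty, cuspMove_infty]
  simp [neg_div_neg_eq]

lemma cuspMove_T_zpow (n : ℤ) (q : ℚ) : cuspMove (T ^ n) (q : OnePoint ℚ) = (q + n : ℚ) := by
  have coe_mapGL : (Matrix.SpecialLinearGroup.mapGL ℚ (T ^ n) : Matrix (Fin 2) (Fin 2) ℚ) =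
      !![1, (n : ℚ); 0, 1] := by
    rw [Matrix.SpecialLinearGroup.mapGL_coe_matrix, Matrix.SpecialLinearGroup.map_apply_coe,
      RingHom.mapMatrix_apply, coe_T_zpow]
    ext i j
    fin_cases i <;> fin_cases j <;> simp
  rw [cuspMove, OnePoint.smul_some_eq_ite, coe_mapGL]
  simp

lemma exists_eq_T_zpow_of_cuspMove_infty {g : SL(2, ℤ)} (hg : cuspMove g ∞ = ∞) :
    ∃ n : ℤ, g = T ^ n ∨ g = -T ^ n := by
  have c_eq : g 1 0 = 0 := by
    by_contra h
    rw [cuspMove_infty, if_neg h] at hg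
    exact OnePoint.coe_ne_infty _ hg
  have det_eq := Matrix.det_fin_two g.1 ▸ g.det_coe
  rw [c_eq, mul_zero, sub_zero] at det_eq
  obtain ⟨ha, hd⟩ | ⟨ha, hd⟩ := Int.eq_one_or_neg_one_of_mul_eq_one' det_eq
  · refine ⟨g 0 1, Or.inl ?_⟩
    ext i j
    fin_cases i <;> fin_cases j <;> simp [ha, hd, c_eq, coe_T_zpow]
  · refine ⟨-g 0 1, Or.inr ?_⟩
    ext i j
    fin_cases i <;> fin_cases j <;> simp [ha, hd, c_eq, coe_T_zpow]

namespace ExtPoint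

lemma move_mul (g h : SL(2, ℤ)) (x : ExtPoint) : x.move (g * h) = (x.move h).move g := by
  cases x with
  | inner z => exact congrArg inner (mul_smul g h z)
  | ideal c => exact congrArg ideal (cuspMove_mul g h c)

lemma move_one (x : ExtPoint) : x.move 1 = x := by
  cases x with
  | inner z => exact congrArg inner (one_smul _ z)
  | ideal c => exact congrArg ideal (cuspMove_one c)

lemma move_inv_move (g : SL(2, ℤ)) (x : ExtPoint) : (x.move g).move g⁻¹ = x := by
  rw [← move_mul, inv_mul_cancel, move_one]

lemma move_injective (g : SL(2, ℤ)) : Function.Injective (move g) :=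
  Function.LeftInverse.injective (move_inv_move g)

lemma move_neg (g : SL(2, ℤ)) (x : ExtPoint) : x.move (-g) = x.move g := by
  cases x with
  | inner z => exact congrArg inner (SL_neg_smul g z)
  | ideal c => exact congrArg ideal (cuspMove_neg g c)

lemma eq_zero_of_move_T_zpow {n : ℤ} {x : ExtPoint} (hx : x ≠ ideal ∞)
    (h : x.move (T ^ n) = x) : n = 0 := by
  obtain z | c := x
  · have h_re := congrArg UpperHalfPlane.re (inner.inj h)
    rw [UpperHalfPlane.modular_T_zpow_smul, UpperHalfPlane.vadd_re] at h_re
    exact_mod_cast add_eq_right.1 h_re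
  · induction c using OnePoint.rec with
    | infty => exact absurd rfl hx
    | coe q =>
      have h_eq := ideal.inj h
      rw [cuspMove_T_zpow, OnePoint.coe_eq_coe, add_eq_left] at h_eq
      exact_mod_cast h_eq

lemma mk_eq_one_of_move_eq {g : SL(2, ℤ)} {x : ExtPoint} (hx : x ≠ ideal ∞)
    (h_infty : cuspMove g ∞ = ∞) (h : x.move g = x) : (QuotientGroup.mk g : PSL(2, ℤ)) = 1 := by
  obtain ⟨n, rfl | rfl⟩ := exists_eq_T_zpow_of_cuspMove_infty h_infty
  · rw [eq_zero_of_move_T_zpow hx h, zpow_zero, QuotientGroup.mk_one]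
  · rw [move_neg] at h
    rw [psl_mk_neg, eq_zero_of_move_T_zpow hx h, zpow_zero, QuotientGroup.mk_one]

lemma mk_eq_mk_of_move_eq {g h : SL(2, ℤ)} {c : OnePoint ℚ} {x : ExtPoint} (hx : x ≠ ideal c)
    (hc : (ideal c).move g = (ideal c).move h) (h_eq : x.move g = x.move h) :
    (QuotientGroup.mk g : PSL(2, ℤ)) = QuotientGroup.mk h := by
  obtain ⟨k, rfl⟩ := c.exists_mem_SL2 ℤ
  change x ≠ (ideal ∞).move k at hx
  change ((ideal ∞).move k).move g = ((ideal ∞).move k).move h at hc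
  have key : (QuotientGroup.mk ((h * k)⁻¹ * (g * k)) : PSL(2, ℤ)) = 1 := by
    refine mk_eq_one_of_move_eq (x := x.move k⁻¹) ?_ (ideal.inj ?_) ?_
    · rwa [ne_eq, ← (move_injective k).eq_iff, ← move_mul, mul_inv_cancel, move_one]
    · change (ideal ∞).move _ = ideal ∞
      rw [move_mul, move_mul, hc, ← move_mul h, move_inv_move]
    · rw [← move_mul, mul_assoc, mul_inv_cancel_right, mul_inv_rev, mul_assoc, move_mul, move_mul,
        h_eq, move_inv_move]
  rw [QuotientGroup.mk_mul, QuotientGroup.mk_inv, inv_mul_eq_one, QuotientGroup.mk_mul,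
    QuotientGroup.mk_mul] at key
  exact (mul_right_cancel key).symm

end ExtPoint

end ExtPoint

noncomputable section AntiperiodicExtension

variable {M : Type*} [AddGroup M] {N : ℕ} [NeZero N] (A : Fin (N + 1) → M)

/-- The extension to `ℤ` of a sequence that changes sign from its first to its last term. -/
def antiperiodicExtension (k : ℤ) : M :=
  ((k / N).negOnePow : ℤ) • A (Fin.ofNat (N + 1) (k % N).toNat)

lemma antiperiodic_antiperiodicExtension : Function.Antiperiodic (antiperiodicExtension A) N :=
  fun k => by
    rw [antiperiodicExtension, Int.add_ediv_of_dvd_right dvd_rfl, Int.add_emod_right,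
      Int.ediv_self (NeZero.ne _), Int.negOnePow_succ, Units.val_neg, neg_zsmul,
      antiperiodicExtension]

variable {A}

lemma antiperiodicExtension_apply (hA : A (Fin.last N) = -A 0) (k : Fin (N + 1)) :
    antiperiodicExtension A k = A k := by
  have apply_castSucc (k : Fin N) : antiperiodicExtension A k.castSucc = A k.castSucc := by
    have h0 : (0 : ℤ) ≤ k := Int.natCast_nonneg _
    have hN : (k : ℤ) < N := Int.ofNat_lt.2 k.2
    rw [antiperiodicExtension, Fin.val_castSucc, Int.ediv_eq_zero_of_lt h0 hN,
      Int.emod_eq_of_lt h0 hN, Int.negOnePow_zero, Units.val_one, one_zsmul, Int.toNat_natCast]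
    congr 1
    ext
    simp
  cases k using Fin.lastCases with
  | cast k => exact apply_castSucc k
  | last =>
    have h := antiperiodic_antiperiodicExtension A 0
    rw [zero_add] at h
    rw [Fin.val_last, h, hA, neg_inj]
    simpa using apply_castSucc 0

end AntiperiodicExtension

lemma periodic_wedge_add {N : ℕ} {v : ℤ → Fin 2 → ℤ} (hv : Function.Antiperiodic v N) (i : ℤ) :
    Function.Periodic (fun k => wedge (v (k + i)) (v k)) N := fun k => by
  dsimp only
  rw [add_right_comm, hv, hv, wedge_neg_left, wedge_neg_right, neg_neg]

noncomputable section OfFin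

variable {N : ℕ} [NeZero N] {A : Fin (N + 1) → Fin 2 → ℤ}

lemma antiperiodicExtension_castSucc (hA : A (Fin.last N) = -A 0) (k : Fin N) :
    antiperiodicExtension A k = A k.castSucc :=
  antiperiodicExtension_apply hA k.castSucc

lemma antiperiodicExtension_succ (hA : A (Fin.last N) = -A 0) (k : Fin N) :
    antiperiodicExtension A (k + 1) = A k.succ := by
  rw [← antiperiodicExtension_apply hA, Fin.val_succ, Nat.cast_succ]

lemma wedge_antiperiodicExtension_pos (hA : A (Fin.last N) = -A 0)
    (h_pos : ∀ k m : Fin N, k < m → 0 < wedge (A m.castSucc) (A k.castSucc)) (k : Fin N) {m : ℤ}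
    (hkm : k < m) (hmk : m < k + N) :
    0 < wedge (antiperiodicExtension A m) (antiperiodicExtension A k) := by
  have pos_of_lt {k m : ℕ} (hkm : k < m) (hm : m < N) :
      0 < wedge (antiperiodicExtension A m) (antiperiodicExtension A k) := by
    have h := h_pos ⟨k, hkm.trans hm⟩ ⟨m, hm⟩ hkm
    rwa [← antiperiodicExtension_castSucc hA, ← antiperiodicExtension_castSucc hA] at h
  lift m to ℕ using (Int.natCast_nonneg _).trans hkm.le
  obtain hm | hm := lt_or_ge m N
  · exact pos_of_lt (by exact_mod_cast hkm) hm
  · obtain ⟨r, rfl⟩ := Nat.exists_eq_add_of_le' hm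
    rw [Nat.cast_add, antiperiodic_antiperiodicExtension, wedge_neg_left, ← wedge_swap]
    exact pos_of_lt (by push_cast at hmk; exact_mod_cast lt_of_add_lt_add_right hmk) k.2

/-- The Farey cycle whose vertices are the rays spanned by the vectors of a finite sequence, where
the last vector represents the first vertex again. -/
def FareyCycle.ofFin (A : Fin (N + 1) → Fin 2 → ℤ) (hA : A (Fin.last N) = -A 0)
    (h_succ : ∀ k : Fin N, wedge (A k.succ) (A k.castSucc) = 1)
    (h_pos : ∀ k m : Fin N, k < m → 0 < wedge (A m.castSucc) (A k.castSucc)) : FareyCycle N where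
  vertex := antiperiodicExtension A
  antiperiodic := antiperiodic_antiperiodicExtension A
  wedge_succ m := by
    obtain ⟨k, hk⟩ := exists_fin_eq_of_periodic
      (periodic_wedge_add (antiperiodic_antiperiodicExtension A) 1) (NeZero.pos N) m
    rw [hk, antiperiodicExtension_succ hA, antiperiodicExtension_castSucc hA, h_succ]
  wedge_pos l m hlm hml := by
    obtain ⟨k, hk⟩ := exists_fin_eq_of_periodic
      (periodic_wedge_add (antiperiodic_antiperiodicExtension A) (m - l)) (NeZero.pos N) l
    rw [add_sub_cancel] at hk
    rw [hk]
    exact wedge_antiperiodicExtension_pos hA h_pos k (by lia) (by lia)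

end OfFin

lemma cuspSeq_eq_ite {n : ℕ} (x : Fin (n + 1) → ℚ) (k : Fin (n + 3)) :
    cuspSeq x k = if denSeq x k = 0 then ∞
      else (((numSeq x k : ℚ) / (denSeq x k : ℚ) : ℚ) : OnePoint ℚ) := by
  cases k using Fin.cases with
  | zero => simp [cuspSeq, denSeq]
  | succ k =>
    cases k using Fin.lastCases with
    | last => simp [cuspSeq, denSeq]
    | cast i => simp [cuspSeq, denSeq, numSeq, Rat.num_div_den]

noncomputable section SpecialPolygonCycle

namespace SpecialPolygon

variable (P : SpecialPolygon)

/-- The vector `(aₖ₋₁, bₖ₋₁)`, which represents the ideal vertex `xₖ₋₁`. -/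
def cuspVec (k : Fin (P.n + 3)) : Fin 2 → ℤ := ![P.a k, P.b k]

lemma cuspVec_last : P.cuspVec (Fin.last _) = -P.cuspVec 0 := by
  rw [← Fin.succ_last]
  simp [cuspVec, a, b, numSeq, denSeq]

lemma wedge_cuspVec_succ (k : Fin (P.n + 2)) :
    wedge (P.cuspVec k.succ) (P.cuspVec k.castSucc) = 1 :=
  farey_relation P.strictMono_x k (P.frame k) (P.frame_zero k) (P.frame_infty k)

lemma wedge_cuspVec_pos {k m : Fin (P.n + 2)} (hkm : k < m) :
    0 < wedge (P.cuspVec m.castSucc) (P.cuspVec k.castSucc) := by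
  obtain ⟨j, rfl⟩ := Fin.exists_succ_eq.2 (Fin.ne_zero_of_lt hkm)
  cases k using Fin.cases with
  | zero =>
    have := (P.x j).den_pos
    simpa [wedge, cuspVec, a, b, numSeq, denSeq, ← Fin.succ_castSucc]
  | succ i =>
    have hij := (Rat.lt_iff _ _).1 (P.strictMono_x (Fin.succ_lt_succ_iff.1 hkm))
    simpa [wedge, cuspVec, a, b, numSeq, denSeq, ← Fin.succ_castSucc, mul_comm] using hij

/-- The Farey cycle of the ideal vertices of a special polygon. -/
def cycle : FareyCycle (P.n + 2) :=
  .ofFin P.cuspVec P.cuspVec_last P.wedge_cuspVec_succ fun _ _ => P.wedge_cuspVec_pos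

lemma cycle_vertex (k : Fin (P.n + 2)) : P.cycle.vertex k = P.cuspVec k.castSucc :=
  antiperiodicExtension_castSucc P.cuspVec_last k

lemma cycle_vertex_add_one (k : Fin (P.n + 2)) : P.cycle.vertex (k + 1) = P.cuspVec k.succ :=
  antiperiodicExtension_succ P.cuspVec_last k

lemma cycle_corner (k : Fin (P.n + 2)) : P.cycle.corner k = P.phi k := by
  refine ext_col ?_ ?_
  · rw [FareyCycle.corner, ofCols_col_zero, cycle_vertex]
    ext i
    fin_cases i <;> rfl
  · rw [FareyCycle.corner, ofCols_col_one, cycle_vertex_add_one]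
    ext i
    fin_cases i <;> rfl

lemma natAbs_eq_fan (k : Fin (P.n + 2)) :
    ((P.a (k - 1).castSucc * P.b k.succ - P.a k.succ * P.b (k - 1).castSucc).natAbs : ℤ) =
      P.cycle.fan k := by
  change ((wedge (P.cuspVec (k - 1).castSucc) (P.cuspVec k.succ)).natAbs : ℤ) = _
  rw [Int.natCast_natAbs, FareyCycle.fan_eq_abs, cycle_vertex, cycle_vertex_add_one]

lemma lt_width_iff (k : Fin (P.n + 2)) (j : ℕ) :
    j < P.width k ↔
      (j : ℤ) < P.cycle.fan k ∨ (j : ℤ) = P.cycle.fan k ∧ P.kind (k - 1) = .odd := by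
  rw [← natAbs_eq_fan, width]
  cases P.kind (k - 1) with
  | odd => simp only [and_true]; lia
  | even => simp only [reduceCtorEq, and_false, or_false]; lia
  | free => simp only [reduceCtorEq, and_false, or_false]; lia

lemma pslEdge_cycle (k : Fin (P.n + 2)) : P.cycle.pslEdge k = QuotientGroup.mk (P.frame k) := by
  have edge_zero : cuspMove (P.cycle.edge k) ((0 : ℚ) : OnePoint ℚ) = cuspSeq P.x k.castSucc := by
    rw [cuspMove_zero, cuspSeq_eq_ite]
    change (if P.cycle.vertex k 1 = 0 then ∞ else
      ((P.cycle.vertex k 0 / P.cycle.vertex k 1 : ℚ) : OnePoint ℚ)) = _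
    rw [cycle_vertex]
    rfl
  have edge_infty : cuspMove (P.cycle.edge k) ∞ = cuspSeq P.x k.succ := by
    rw [cuspMove_infty, cuspSeq_eq_ite]
    change (if P.cycle.vertex (k + 1) 1 = 0 then ∞ else
      ((P.cycle.vertex (k + 1) 0 / P.cycle.vertex (k + 1) 1 : ℚ) : OnePoint ℚ)) = _
    rw [cycle_vertex_add_one]
    rfl
  refine ExtPoint.mk_eq_mk_of_move_eq (c := ∞) (x := .ideal (0 : ℚ)) (by simp) ?_ ?_
  · exact congrArg ExtPoint.ideal (edge_infty.trans (P.frame_infty k).symm)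
  · exact congrArg ExtPoint.ideal (edge_zero.trans (P.frame_zero k).symm)

end SpecialPolygon

end SpecialPolygonCycle

noncomputable section MapsReversing

namespace OrientedArc

/-- The image of an oriented arc under an element of `SL(2, ℤ)`. -/
def move (g : SL(2, ℤ)) (s : OrientedArc) : OrientedArc := ⟨s.source.move g, s.target.move g⟩

end OrientedArc

namespace MapsReversing

variable {γ δ : SL(2, ℤ)} {s t : OrientedArc}

lemma conj (h : MapsReversing γ s t) (g k : SL(2, ℤ)) :
    MapsReversing (k * γ * g⁻¹) (s.move g) (t.move k) := by
  constructor
  · change (s.source.move g).move _ = t.target.move k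
    rw [ExtPoint.move_mul, ExtPoint.move_inv_move, ExtPoint.move_mul, h.1]
  · change (s.target.move g).move _ = t.source.move k
    rw [ExtPoint.move_mul, ExtPoint.move_inv_move, ExtPoint.move_mul, h.2]

lemma mk_eq_mk {c : OnePoint ℚ} (hγ : MapsReversing γ s t) (hδ : MapsReversing δ s t)
    (h_source : s.source = .ideal c) (h_target : s.target ≠ s.source) :
    (QuotientGroup.mk γ : PSL(2, ℤ)) = QuotientGroup.mk δ :=
  ExtPoint.mk_eq_mk_of_move_eq (h_source ▸ h_target) (h_source ▸ hγ.1.trans hδ.1.symm)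
    (hγ.2.trans hδ.2.symm)

end MapsReversing

end MapsReversing

noncomputable section PairingKind

open ModularGroup
open scoped UpperHalfPlane

lemma cuspMove_S_zero : cuspMove S ((0 : ℚ) : OnePoint ℚ) = ∞ := by
  rw [cuspMove_zero]
  simp [S]

lemma cuspMove_S_infty : cuspMove S ∞ = ((0 : ℚ) : OnePoint ℚ) := by
  rw [cuspMove_infty]
  simp [S]

lemma cuspMove_TS_zero : cuspMove (T * S) ((0 : ℚ) : OnePoint ℚ) = ∞ := by
  rw [cuspMove_mul, cuspMove_S_zero, cuspMove_infty]
  simp [T]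

lemma S_smul_I : S • UpperHalfPlane.I = UpperHalfPlane.I := by
  rw [UpperHalfPlane.modular_S_smul]
  ext1
  simp

lemma normSq_rhoPoint : Complex.normSq rhoPoint = 1 := by
  change 1 / 2 * (1 / 2) + √3 / 2 * (√3 / 2) = (1 : ℝ)
  linarith [Real.mul_self_sqrt (show (0 : ℝ) ≤ 3 by norm_num)]

lemma TS_smul_rhoPoint : (T * S) • rhoPoint = rhoPoint := by
  refine UpperHalfPlane.ext (Complex.ext ?_ ?_)
  · change ((T * S) • rhoPoint).re = 1 / 2
    rw [mul_smul, re_T_smul, re_S_smul, normSq_rhoPoint, show rhoPoint.re = 1 / 2 from rfl]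
    norm_num
  · change ((T * S) • rhoPoint).im = rhoPoint.im
    rw [mul_smul, im_T_smul, im_smul_eq_div_normSq]
    simp [denom_S, normSq_rhoPoint]

namespace PairingKind

/-- The first side of a boundary piece with the given pairing that runs from `0` to `∞`. -/
def side : PairingKind → OrientedArc
  | even => ⟨.ideal (0 : ℚ), .inner UpperHalfPlane.I⟩
  | odd => ⟨.ideal (0 : ℚ), .inner rhoPoint⟩
  | free => ⟨.ideal (0 : ℚ), .ideal ∞⟩

/-- The side of a boundary piece from `0` to `∞` onto which `side` is mapped by its side pairing
transformation, up to the position of the partner of a free side. -/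
def pairedSide : PairingKind → OrientedArc
  | even => ⟨.inner UpperHalfPlane.I, .ideal ∞⟩
  | odd => ⟨.inner rhoPoint, .ideal ∞⟩
  | free => ⟨.ideal (0 : ℚ), .ideal ∞⟩

/-- The side pairing transformation from `side` to `pairedSide`. -/
def pairing : PairingKind → SL(2, ℤ)
  | odd => T * S
  | _ => S

lemma mapsReversing_pairing (p : PairingKind) : MapsReversing p.pairing p.side p.pairedSide := by
  cases p with
  | even => exact ⟨congrArg ExtPoint.ideal cuspMove_S_zero, congrArg ExtPoint.inner S_smul_I⟩
  | odd =>
    exact ⟨congrArg ExtPoint.ideal cuspMove_TS_zero, congrArg ExtPoint.inner TS_smul_rhoPoint⟩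
  | free =>
    exact ⟨congrArg ExtPoint.ideal cuspMove_S_zero, congrArg ExtPoint.ideal cuspMove_S_infty⟩

lemma side_source (p : PairingKind) : p.side.source = .ideal (0 : ℚ) := by
  cases p <;> rfl

lemma side_target_ne_source (p : PairingKind) : p.side.target ≠ p.side.source := by
  cases p <;> simp [side]

lemma pairing_of_ne_odd {p : PairingKind} (hp : p ≠ .odd) : p.pairing = S := by
  cases p with
  | odd => exact absurd rfl hp
  | _ => rfl

end PairingKind

end PairingKind

noncomputable section SpecialPolygonPairing

open ModularGroup
open scoped UpperHalfPlane

namespace SpecialPolygon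

variable (P : SpecialPolygon)

lemma partner_eq_self {k : Fin (P.n + 2)} (hk : P.kind k ≠ .free) : P.partner k = k :=
  (P.partner_eq_self_iff k).2 hk

lemma sidePairing_iff (s t : OrientedArc) :
    P.SidePairing s t ↔ ∃ k, s = (P.kind k).side.move (P.frame k) ∧
      t = (P.kind k).pairedSide.move (P.frame (P.partner k)) := by
  have move_zero (k) : (ExtPoint.ideal (0 : ℚ)).move (P.frame k) = P.initialCusp k :=
    congrArg ExtPoint.ideal (P.frame_zero k)
  have move_infty (k) : (ExtPoint.ideal ∞).move (P.frame k) = P.terminalCusp k :=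
    congrArg ExtPoint.ideal (P.frame_infty k)
  have move_I (k) : (ExtPoint.inner UpperHalfPlane.I).move (P.frame k) = P.evenPoint k := rfl
  have move_rho (k) : (ExtPoint.inner rhoPoint).move (P.frame k) = P.oddPoint k := rfl
  constructor
  · rintro (⟨k, hk⟩ | ⟨k, hk⟩ | ⟨k, hk⟩) <;> refine ⟨k, ?_, ?_⟩ <;>
      simp [PairingKind.side, PairingKind.pairedSide, OrientedArc.move, partner_eq_self, *]
  · rintro ⟨k, rfl, rfl⟩
    cases hk : P.kind k with
    | even =>
      simpa only [PairingKind.side, PairingKind.pairedSide, OrientedArc.move, move_zero, move_infty,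
        move_I, P.partner_eq_self (k := k) (by simp [hk])] using SidePairing.even k hk
    | odd =>
      simpa only [PairingKind.side, PairingKind.pairedSide, OrientedArc.move, move_zero, move_infty,
        move_rho, P.partner_eq_self (k := k) (by simp [hk])] using SidePairing.odd k hk
    | free =>
      simpa only [PairingKind.side, PairingKind.pairedSide, OrientedArc.move, move_zero,
        move_infty] using SidePairing.free k hk

lemma re_nonpos_of_mem_leftPart {p : PairingKind} (hp : p ≠ .odd) {γ : SL(2, ℤ)} {z : ℍ}
    (hz : z ∈ leftPart p γ) : (γ⁻¹ • z).re ≤ 0 := by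
  cases p with
  | odd => exact absurd rfl hp
  | _ => exact hz

lemma interior_setOf_re_smul_eq_zero (g : SL(2, ℤ)) : interior {z : ℍ | (g • z).re = 0} = ∅ := by
  have re_smul_isOpenMap : IsOpenMap fun z : ℍ => (g • z).re :=
    UpperHalfPlane.isOpenMap_re.comp (isOpenMap_smul (Matrix.SpecialLinearGroup.mapGL ℝ g))
  have h := re_smul_isOpenMap.interior_preimage_subset_preimage_interior (s := {0})
  rwa [interior_singleton, Set.preimage_empty, Set.subset_empty_iff] at h

lemma exists_kind_eq_odd (hn : P.n + 2 = 2) : ∃ k, P.kind k = .odd := by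
  by_contra! h_odd
  have smul_eq (z : ℍ) : (P.frame 0)⁻¹ • z = S • (P.frame 1)⁻¹ • z := by
    have pslEdge_eq := P.cycle.pslEdge_mul_pslS_of_ne hn (k := 1) (m := 0) (by simp)
    rw [pslEdge_cycle, pslEdge_cycle] at pslEdge_eq
    change (QuotientGroup.mk (P.frame 0) : PSL(2, ℤ))⁻¹ • z =
      pslS • (QuotientGroup.mk (P.frame 1) : PSL(2, ℤ))⁻¹ • z
    rw [← pslEdge_eq, mul_inv_rev, mul_smul, inv_eq_of_mul_eq_one_left pslS_mul_self]
  refine P.interior_nonempty.ne_empty (Set.subset_empty_iff.1 ?_)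
  rw [← interior_setOf_re_smul_eq_zero (P.frame 1)⁻¹]
  refine interior_mono fun z hz => ?_
  have re_nonpos (k) := re_nonpos_of_mem_leftPart (h_odd k) (Set.mem_iInter.1 hz k)
  refine (re_nonpos 1).antisymm (not_lt.1 (mt re_S_smul_pos_iff.2 ?_))
  rw [← smul_eq]
  exact (re_nonpos 0).not_gt

lemma group_eq_closure : P.group = Subgroup.closure (Set.range fun k =>
    QuotientGroup.mk (P.frame (P.partner k) * (P.kind k).pairing * (P.frame k)⁻¹)) := by
  rw [group]
  congr 1
  ext α
  have mapsReversing (k) := (P.kind k).mapsReversing_pairing.conj (P.frame k)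
    (P.frame (P.partner k))
  constructor
  · rintro ⟨γ, s, t, hst, hγ, rfl⟩
    obtain ⟨k, rfl, rfl⟩ := (P.sidePairing_iff s t).1 hst
    exact ⟨k, (mapsReversing k).mk_eq_mk hγ (congrArg (ExtPoint.move _) (P.kind k).side_source)
      ((ExtPoint.move_injective _).ne (P.kind k).side_target_ne_source)⟩
  · rintro ⟨k, rfl⟩
    exact ⟨_, _, _, (P.sidePairing_iff _ _).2 ⟨k, rfl, rfl⟩, mapsReversing k, rfl⟩

lemma kind_partner_ne_odd {k : Fin (P.n + 2)} (hk : P.kind k ≠ .odd) :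
    P.kind (P.partner k) ≠ .odd := by
  intro h_odd
  have partner_partner := P.partner_eq_self (k := P.partner k) (by simp [h_odd])
  rw [P.partner_partner] at partner_partner
  exact hk (partner_partner ▸ h_odd)

/-- The side pairing of a special polygon. -/
def gluing : SideGluing (P.n + 2) where
  IsOdd k := P.kind k = .odd
  partner := P.partner
  partner_partner := P.partner_partner
  not_isOdd_partner _ := P.kind_partner_ne_odd
  exists_isOdd := P.exists_kind_eq_odd

lemma group_eq_closure_pairings :
    P.group = Subgroup.closure (P.gluing.pairings P.cycle) := by
  rw [group_eq_closure]
  congr 1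
  ext γ
  refine exists_congr fun k => ?_
  change QuotientGroup.mk (P.frame (P.partner k) * (P.kind k).pairing * (P.frame k)⁻¹) = γ ↔
    (P.kind k ≠ .odd ∧ γ = P.cycle.pslEdge (P.partner k) * pslS * (P.cycle.pslEdge k)⁻¹) ∨
      (P.kind k = .odd ∧ γ = P.cycle.pslEdge k * pslU * (P.cycle.pslEdge k)⁻¹)
  rw [pslEdge_cycle, pslEdge_cycle, eq_comm]
  by_cases hk : P.kind k = .odd
  · rw [P.partner_eq_self (k := k) (by simp [hk])]
    simp only [hk, ne_eq, not_true, false_and, true_and, false_or]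
    rfl
  · simp only [hk, ne_eq, not_false_eq_true, true_and, false_and, or_false,
      PairingKind.pairing_of_ne_odd hk]
    rfl

end SpecialPolygon

end SpecialPolygonPairing

section SpecialPolygonTiles

open scoped Pointwise

namespace SpecialPolygon

variable (P : SpecialPolygon)

lemma inv_pslCorner_cycle (k : Fin (P.n + 2)) (j : ℕ) :
    (P.cycle.pslCorner k j)⁻¹ =
      QuotientGroup.mk ((ModularGroup.T ^ j)⁻¹ * (P.phi k)⁻¹) := by
  rw [FareyCycle.pslCorner, cycle_corner, zpow_natCast, ← QuotientGroup.mk_inv, mul_inv_rev]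

lemma inv_tiles_gluing : (P.gluing.tiles P.cycle)⁻¹ =
    ⋃ k : Fin (P.n + 2), {α : PSL(2, ℤ) | ∃ j : ℕ, j < P.width k ∧
      α = QuotientGroup.mk ((ModularGroup.T ^ j)⁻¹ * (P.phi k)⁻¹)} := by
  ext α
  rw [Set.mem_inv, SideGluing.mem_tiles_iff, Set.mem_iUnion]
  refine exists_congr fun k => ⟨?_, ?_⟩
  · rintro ⟨j, h0, hj, hα⟩
    lift j to ℕ using h0
    exact ⟨j, (P.lt_width_iff k j).2 hj, by rw [← inv_pslCorner_cycle, ← hα, inv_inv]⟩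
  · rintro ⟨j, hj, rfl⟩
    exact ⟨j, j.cast_nonneg, (P.lt_width_iff k j).1 hj, by rw [← inv_pslCorner_cycle, inv_inv]⟩

end SpecialPolygon

end SpecialPolygonTiles

/-- If `Γ = Γ_P` for a special polygon `P`, then the elements `T⁻ʲ φᵢ⁻¹` with `0 ≤ j < wᵢ`, where
`xᵢ` runs through all ideal vertices of `P`, form a complete set of representatives of the left
cosets `α Γ` in `PSL(2, ℤ)`. -/
theorem mainTheorem3 (Γ : Subgroup PSL(2, ℤ)) (P : SpecialPolygon) (hP : P.group = Γ) :
    Subgroup.IsComplement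
      (⋃ k : Fin (P.n + 2), {α : PSL(2, ℤ) | ∃ j : ℕ, j < P.width k ∧
        α = QuotientGroup.mk ((ModularGroup.T ^ j)⁻¹ * (P.phi k)⁻¹)})
      (Γ : Set PSL(2, ℤ)) := by
  rw [← hP, P.group_eq_closure_pairings, ← P.inv_tiles_gluing]
  exact P.gluing.isComplement_inv_tiles P.cycle
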